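/- Setting. For each $n$ let $\{\mathbf Z_t\}_{t\in\mathbb Z}$ be an $\mathbb R^{p_n}$-valued process on a probability space (the process, the space and all objects below except the kernel $K$ and the constants may depend on $n$; $p_n$ is arbitrary). Let $m_n,h_n,\ell_n$ be non-negative integers (difference order, lag spacing, bandwidth), $d_{n,0},\dots,d_{n,m_n}$ real numbers with $$\sum_{j=0}^{m_n}d_{n,j}=0,\qquad \sum_{j=0}^{m_n}d_{n,j}^2=1,$$ and $K:\mathbb R\to\mathbb R$ a kernel. Put $\mathbf U_t=\sum_{j=0}^{m_n}d_{n,j}\mathbf Z_{t-jh_n}$ and define the oracle estimator $$\widehat{\mathbf\Gamma}^{U}_k=\frac1n\sum_{t=m_nh_n+|k|+1}^{n}\mathbf U_t\mathbf U_{t-|k|}^\top,\qquad \widehat{\mathbf V}^{\mathrm{or}}=\sum_{|k|<\ell_n}K\!\left(\frac{k}{\ell_n}\right)\widehat{\mathbf\Gamma}^{U}_k .$$ For a real random variable $X$ let $\|X\|_{\psi_2}=\inf\{s>0:\mathbb E\exp(X^2/s^2)\le2\}$, and let $\|\cdot\|_{\mathrm{op}}$ be the spectral norm. Assumptions. There are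 real constants $q_0,\eta>0$ and $K_\varepsilon,K_A,\widetilde K_A,K_0,K_d$, not depending on $n$, such that for all $n$: (U0) $\mathbf Z_t=\sum_{a=0}^\infty\mathbf A_a\boldsymbol\varepsilon_{t-a}$ almost surely for every $t\in\mathbb Z$, where the $\mathbf A_a$ are deterministic $p_n\times p_n$ matrices and the innovations $\boldsymbol\varepsilon_t$, $t\in\mathbb Z$, are i.i.d. random vectors in $\mathbb R^{p_n}$. (U1) For each $t$ the coordinates of $\boldsymbol\varepsilon_t$ are independent, $\mathbb E\boldsymbol\varepsilon_t=\mathbf 0$, and $\max_{1\le j\le p_n}\|\varepsilon_{0,j}\|_{\psi_2}\le K_\varepsilon$. (U2) $\sum_{a\ge0}\|\mathbf A_a\|_{\mathrm{op}}\le K_A$, and $\|\mathbf A_a\|_{\mathrm{op}}\le\widetilde K_A(1+a)^{-(q_0+2+\eta)}$ for all $a\ge0$. (U3) $\sup_{|x|\le1}|K(x)|\le K_0$ and $\sum_{j=0}^{m_n}|d_{n,j}|\le K_d$. (U4) $\ell_n\le h_n$, and as $n\to\infty$, $\ell_n=o(h_n)$ and $h_n^{q_0+1+\eta}/\ell_n^{q_0+1}\to\infty$.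 Proposition. There is a constant $c_1>0$ depending only on $K_\varepsilon,K_A,K_0,K_d$ such that, under these assumptions, the entries of $\widehat{\mathbf V}^{\mathrm{or}}$ are integrable and, for all sufficiently large $n$, all $1\le r,s\le p_n$ and all $t>0$, $$\mathbb P\Big(\big|\widehat{\mathbf V}^{\mathrm{or}}[r,s]-\mathbb E\widehat{\mathbf V}^{\mathrm{or}}[r,s]\big|>t\Big)\le2\exp\Big[-c_1n\min\Big\{\frac{t^2}{\ell_n},\frac{t}{\ell_n}\Big\}\Big].$$ In particular, the entrywise concentration assumption holds: there is a constant $c>0$ such that for all sufficiently large $n$, all $1\le r,s\le p_n$ and all $t>0$, $$\mathbb P\Big(\big|\widehat{\mathbf V}^{\mathrm{or}}[r,s]-\mathbb E\widehat{\mathbf V}^{\mathrm{or}}[r,s]\big|>t\Big)\le2\exp\Big[-c\,n\min\Big\{\frac{t^2}{\ell_n+m_nh_n},\frac{t}{\ell_n+m_nh_n}\Big\}\Big].$$ -/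

import Mathlib

open MeasureTheory ProbabilityTheory Filter Asymptotics
open scoped ENNReal Topology

/-- The sub-Gaussian (Orlicz `ψ₂`) norm `inf {s > 0 : E exp (X² / s²) ≤ 2}` of a random variable;
it is `∞` if there is no such `s`. -/
noncomputable def psiTwoNorm {Ω : Type*} [MeasurableSpace Ω] (P : Measure Ω) (X : Ω → ℝ) : ℝ≥0∞ :=
  ⨅ (s : ℝ) (_ : 0 < s) (_ : ∫⁻ ω, ENNReal.ofReal (Real.exp (X ω ^ 2 / s ^ 2)) ∂P ≤ 2),
    ENNReal.ofReal s

/-- The spectral norm of a matrix, that is, its operator norm for the Euclidean norm. -/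
noncomputable def matrixOpNorm {p : ℕ} (A : Matrix (Fin p) (Fin p) ℝ) : ℝ :=
  ‖Matrix.toEuclideanCLM (𝕜 := ℝ) A‖

/-- I.i.d. centred innovations in `ℝᵖ` with independent coordinates whose `ψ₂`-norms are
at most `Kε`. -/
structure IsSubGaussianInnovation {Ω : Type*} [MeasurableSpace Ω] (P : Measure Ω) {p : ℕ}
    (ε : ℤ → Ω → Fin p → ℝ) (Kε : ℝ) : Prop where
  measurable : ∀ t, Measurable (ε t)
  indep_time : iIndepFun ε P
  identDistrib : ∀ t, IdentDistrib (ε t) (ε 0) P P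
  indep_coord : ∀ t, iIndepFun (fun (j : Fin p) (ω : Ω) => ε t ω j) P
  centered : ∀ t j, ∫ ω, ε t ω j ∂P = 0
  psiTwo_le : ∀ j, psiTwoNorm P (fun ω => ε 0 ω j) ≤ ENNReal.ofReal Kε

/-- A filter with summable operator norms (with sum at most `KA`), which decay polynomially with
exponent `β`. -/
structure IsStableFilter {p : ℕ} (A : ℕ → Matrix (Fin p) (Fin p) ℝ) (KA KA' β : ℝ) : Prop where
  summable : Summable fun a => matrixOpNorm (A a)
  tsum_le : ∑' a, matrixOpNorm (A a) ≤ KA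
  decay : ∀ a : ℕ, matrixOpNorm (A a) ≤ KA' * (1 + (a : ℝ)) ^ (-β)

/-- `Z` is the linear process `Z_t = ∑_{a ≥ 0} A_a ε_{t-a}`, the series converging almost surely
(unconditionally). -/
def IsLinearProcess {Ω : Type*} [MeasurableSpace Ω] (P : Measure Ω) {p : ℕ}
    (Z : ℤ → Ω → Fin p → ℝ) (A : ℕ → Matrix (Fin p) (Fin p) ℝ) (ε : ℤ → Ω → Fin p → ℝ) : Prop :=
  ∀ t : ℤ, ∀ᵐ ω ∂P, HasSum (fun a : ℕ => (A a).mulVec (ε (t - (a : ℤ)) ω)) (Z t ω)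

/-- The noise-only difference process `U_t = ∑_{j=0}^m d_j Z_{t - j h}`. -/
def noiseDiff {Ω : Type*} {p : ℕ} (m h : ℕ) (d : ℕ → ℝ) (Z : ℤ → Ω → Fin p → ℝ)
    (t : ℤ) (ω : Ω) : Fin p → ℝ :=
  ∑ j ∈ Finset.range (m + 1), d j • Z (t - (j : ℤ) * (h : ℤ)) ω

/-- The oracle autocovariance matrix
`Γ̂ᵁ_k = n⁻¹ ∑_{t = m h + |k| + 1}^n U_t U_{t-|k|}ᵀ`. -/
noncomputable def oracleAutocov {Ω : Type*} {p : ℕ} (n m h : ℕ) (d : ℕ → ℝ)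
    (Z : ℤ → Ω → Fin p → ℝ) (k : ℤ) (ω : Ω) : Matrix (Fin p) (Fin p) ℝ :=
  (n : ℝ)⁻¹ • ∑ t ∈ Finset.Icc ((m : ℤ) * (h : ℤ) + |k| + 1) (n : ℤ),
    Matrix.vecMulVec (noiseDiff m h d Z t ω) (noiseDiff m h d Z (t - |k|) ω)

/-- The oracle long-run covariance estimator `V̂ᵒʳ = ∑_{|k| < ℓ} K(k/ℓ) Γ̂ᵁ_k`. -/
noncomputable def oracleLRV {Ω : Type*} {p : ℕ} (K : ℝ → ℝ) (n m h ℓ : ℕ) (d : ℕ → ℝ)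
    (Z : ℤ → Ω → Fin p → ℝ) (ω : Ω) : Matrix (Fin p) (Fin p) ℝ :=
  ∑ k ∈ Finset.Ioo (-(ℓ : ℤ)) (ℓ : ℤ), K ((k : ℝ) / (ℓ : ℝ)) • oracleAutocov n m h d Z k ω

/-- The uniform Bernstein-type tail bound with constant `c` and scale `L n` for the entries of a
sequence `V n` of random `p n × p n` matrices, for all large `n`. -/
def EntrywiseBernstein {Ω : ℕ → Type*} [∀ n, MeasurableSpace (Ω n)] (P : ∀ n, Measure (Ω n))
    {p : ℕ → ℕ} (V : ∀ n, Ω n → Matrix (Fin (p n)) (Fin (p n)) ℝ) (L : ℕ → ℝ) (c : ℝ) : Prop :=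
  ∀ᶠ n in atTop, ∀ r s : Fin (p n), ∀ t : ℝ, 0 < t →
    (P n).real {ω | t < |V n ω r s - ∫ ω', V n ω' r s ∂(P n)|} ≤
      2 * Real.exp (-(c * (n : ℝ) * min (t ^ 2 / L n) (t / L n)))

/-!
Every entry of the oracle estimator is a quadratic form in the innovations, so its tail is governed
by the Hanson–Wright inequality.

*The quadratic form.* For the process truncated to finitely many filter coefficients, the observed
coordinates of `U_t` are `R x`, with `x` the finite vector of innovation coordinates and `R` a
moving average. Young's inequality gives `‖R‖ ≤ (∑ |d_j|) (∑ ‖A_a‖) ≤ Kd KA`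
(`hasL2Bound_noiseDiffMatrix`). The entry `(r, s)` of the estimator is then `xᵀ (Rᵀ W R') x`, where
the lag-window matrix `W` is banded with at most `ℓ` nonzero entries per row, each of size
`O(1 / n)`. Hence `‖W‖ = O(ℓ / n)` by the Schur test and `‖W‖_F² = O(ℓ / n)`, and the same holds
for `Rᵀ W R'`, uniformly in the dimension, the difference order and the truncation level.

*Hanson–Wright* (`lintegral_exp_quadratic_le`). The diagonal part of the form is a sum of
independent sub-exponential variables. The off-diagonal part is decoupled: it is four times an
average, over subsets `I` of the coordinates, of bilinear forms between the coordinates in `I` and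
the others. By Jensen's inequality it is enough to treat these bilinear forms. Conditionally on the
coordinates outside `I` they are linear, which leaves an exponential moment of a square `|B x|²`.
This is linearized by an auxiliary Gaussian vector in an orthonormal basis diagonalizing `Bᵀ B`,
and only one-dimensional Gaussian integrals remain.

*The limit.* The truncated process converges almost surely, and the products of its values are
dominated by integrable functions. So the entries of the estimator are integrable, the expectations
converge, and by Fatou's lemma the bound on the moment generating function survives. The tail bound
follows from Chernoff's inequality with exponent proportional to `(n / ℓ) min (t, 1)`. Since
`ℓ ≤ ℓ + m h`, it implies the bound at the larger scale as soon as `ℓ > 0`, which the rate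
condition ensures for large `n`.
-/

/-! ### Sub-Gaussian and sub-exponential moment bounds -/

/-- The inequality that turns a `ψ₂`-bound on a centred variable into a Gaussian bound for small
arguments of its moment generating function. -/
theorem exp_le_self_add_exp_sq (x : ℝ) : Real.exp x ≤ x + Real.exp (x ^ 2) := by
  have h2 := Real.add_one_le_exp (x ^ 2)
  rcases le_total |x| 1 with h | h
  · have h1 := abs_le.1 (Real.abs_exp_sub_one_sub_id_le h)
    linarith [h1.2]
  · rcases le_abs.1 h with h | h
    · have : Real.exp x ≤ Real.exp (x ^ 2) := Real.exp_le_exp.2 (by nlinarith)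
      linarith
    · have : Real.exp x ≤ 1 := Real.exp_le_one_iff.2 (by linarith)
      nlinarith

theorem exp_le_one_add_self_add_sq_mul_exp_abs (x : ℝ) :
    Real.exp x ≤ 1 + x + x ^ 2 * Real.exp |x| := by
  have h := Complex.norm_exp_sub_sum_le_norm_mul_exp (x : ℂ) 2
  have e : Complex.exp (x : ℂ) - ∑ m ∈ Finset.range 2, (x : ℂ) ^ m / (m.factorial : ℂ)
      = ((Real.exp x - (1 + x) : ℝ) : ℂ) := by
    simp [Finset.sum_range_succ]
  rw [e, Complex.norm_real, Complex.norm_real, Real.norm_eq_abs, Real.norm_eq_abs, sq_abs] at h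
  linarith [(abs_le.1 h).2]

/-- By convexity of `exp` between `0` and `w`. -/
theorem exp_mul_le_one_add {θ w : ℝ} (h0 : 0 ≤ θ) (h1 : θ ≤ 1) :
    Real.exp (θ * w) ≤ 1 + θ * (Real.exp w - 1) := by
  have := convexOn_exp.2 (Set.mem_univ 0) (Set.mem_univ w) (sub_nonneg.2 h1) h0 (by ring)
  simp only [smul_eq_mul, mul_zero, zero_add, Real.exp_zero, mul_one] at this
  linarith

section Orlicz

variable {Ω : Type*} [MeasurableSpace Ω] {P : Measure Ω} {X : Ω → ℝ} {σ : ℝ}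

theorem integrable_exp_sq_div (hX : Measurable X)
    (h : ∫⁻ ω, ENNReal.ofReal (Real.exp (X ω ^ 2 / σ ^ 2)) ∂P ≤ 2) :
    Integrable (fun ω => Real.exp (X ω ^ 2 / σ ^ 2)) P := by
  refine ⟨by fun_prop, ?_⟩
  rw [hasFiniteIntegral_iff_ofReal (ae_of_all _ fun _ => (Real.exp_pos _).le)]
  exact h.trans_lt (by simp)

theorem integral_exp_sq_div_le (hX : Measurable X)
    (h : ∫⁻ ω, ENNReal.ofReal (Real.exp (X ω ^ 2 / σ ^ 2)) ∂P ≤ 2) :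
    ∫ ω, Real.exp (X ω ^ 2 / σ ^ 2) ∂P ≤ 2 := by
  rw [← ENNReal.ofReal_le_ofReal_iff (by norm_num),
    ofReal_integral_eq_lintegral_ofReal (integrable_exp_sq_div hX h)
      (ae_of_all _ fun _ => (Real.exp_pos _).le)]
  simpa using h

theorem integrable_sq_of_exp_sq (hσ : 0 < σ) (hX : Measurable X)
    (h : ∫⁻ ω, ENNReal.ofReal (Real.exp (X ω ^ 2 / σ ^ 2)) ∂P ≤ 2) :
    Integrable (fun ω => X ω ^ 2) P := by
  refine ((integrable_exp_sq_div hX h).const_mul (σ ^ 2)).mono' (by fun_prop)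
    (ae_of_all _ fun ω => ?_)
  have h1 := Real.add_one_le_exp (X ω ^ 2 / σ ^ 2)
  have hs : 0 < σ ^ 2 := by positivity
  rw [Real.norm_eq_abs, abs_of_nonneg (sq_nonneg _)]
  calc X ω ^ 2 = σ ^ 2 * (X ω ^ 2 / σ ^ 2) := by field_simp
    _ ≤ _ := mul_le_mul_of_nonneg_left (by linarith) hs.le

theorem memLp_two_of_exp_sq (hσ : 0 < σ) (hX : Measurable X)
    (h : ∫⁻ ω, ENNReal.ofReal (Real.exp (X ω ^ 2 / σ ^ 2)) ∂P ≤ 2) : MemLp X 2 P :=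
  (memLp_two_iff_integrable_sq hX.aestronglyMeasurable).2 (integrable_sq_of_exp_sq hσ hX h)

variable [IsProbabilityMeasure P]

theorem integral_sq_div_le_one (hσ : 0 < σ) (hX : Measurable X)
    (h : ∫⁻ ω, ENNReal.ofReal (Real.exp (X ω ^ 2 / σ ^ 2)) ∂P ≤ 2) :
    ∫ ω, X ω ^ 2 / σ ^ 2 ∂P ≤ 1 := by
  have h1 := integral_mono ((integrable_sq_of_exp_sq hσ hX h).div_const (σ ^ 2))
    ((integrable_exp_sq_div hX h).sub (integrable_const (1 : ℝ)))
    (fun ω => by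
      have := Real.add_one_le_exp (X ω ^ 2 / σ ^ 2)
      simp only [Pi.sub_apply]; linarith)
  simp only [Pi.sub_apply] at h1
  rw [integral_sub (integrable_exp_sq_div hX h) (integrable_const _)] at h1
  have := integral_exp_sq_div_le hX h
  simp only [integral_const, probReal_univ, smul_eq_mul, mul_one] at h1
  linarith

/-- A centred random variable with `ψ₂`-norm at most `σ` has a sub-Gaussian moment generating
function with variance proxy `3 σ²`. -/
theorem hasSubgaussianMGF_of_exp_sq (hσ : 0 < σ) (hX : Measurable X)
    (h : ∫⁻ ω, ENNReal.ofReal (Real.exp (X ω ^ 2 / σ ^ 2)) ∂P ≤ 2) (h0 : ∫ ω, X ω ∂P = 0) :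
    HasSubgaussianMGF X ⟨3 * σ ^ 2, by positivity⟩ P := by
  have hi := integrable_exp_sq_div hX h
  have hE := integral_exp_sq_div_le hX h
  have hs : 0 < σ ^ 2 := by positivity
  have hXi : Integrable X P := (memLp_two_of_exp_sq hσ hX h).integrable (by norm_num)
  -- Young's inequality, used for integrability and for large `u`.
  have young : ∀ (u : ℝ) ω, Real.exp (u * X ω)
      ≤ Real.exp (u ^ 2 * σ ^ 2 / 2) * Real.exp (X ω ^ 2 / σ ^ 2) := by
    intro u ω
    rw [← Real.exp_add]
    refine Real.exp_le_exp.2 ?_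
    have h1 : 0 ≤ (u * σ - X ω / σ) ^ 2 / 2 := by positivity
    have h2 : (u * σ - X ω / σ) ^ 2 / 2
        = u ^ 2 * σ ^ 2 / 2 + X ω ^ 2 / σ ^ 2 / 2 - u * X ω := by field_simp; ring
    have h3 : 0 ≤ X ω ^ 2 / σ ^ 2 := by positivity
    linarith
  refine ⟨fun u => ?_, fun u => ?_⟩
  · refine (hi.const_mul (Real.exp (u ^ 2 * σ ^ 2 / 2))).mono' (by fun_prop)
      (ae_of_all _ fun ω => ?_)
    rw [Real.norm_eq_abs, abs_of_pos (Real.exp_pos _)]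
    exact young u ω
  · have hpos : 0 ≤ u ^ 2 * σ ^ 2 := by positivity
    change mgf X P u ≤ Real.exp (3 * σ ^ 2 * u ^ 2 / 2)
    rcases le_total (u ^ 2 * σ ^ 2) 1 with hu | hu
    · have hb : ∀ ω, Real.exp (u * X ω)
          ≤ u * X ω + (1 + u ^ 2 * σ ^ 2 * (Real.exp (X ω ^ 2 / σ ^ 2) - 1)) := by
        intro ω
        have h1 := exp_le_self_add_exp_sq (u * X ω)
        have h2 := exp_mul_le_one_add (w := X ω ^ 2 / σ ^ 2) hpos hu
        have h3 : u ^ 2 * σ ^ 2 * (X ω ^ 2 / σ ^ 2) = (u * X ω) ^ 2 := by field_simp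
        rw [h3] at h2
        linarith
      have hI : Integrable (fun ω => 1 + u ^ 2 * σ ^ 2 * (Real.exp (X ω ^ 2 / σ ^ 2) - 1)) P :=
        (integrable_const _).add ((hi.sub (integrable_const _)).const_mul _)
      have h1 : mgf X P u ≤ _ := integral_mono_of_nonneg (ae_of_all _ fun ω => (Real.exp_pos _).le)
        ((hXi.const_mul u).add hI) (ae_of_all _ hb)
      have h2 : ∫ ω, (u * X ω + (1 + u ^ 2 * σ ^ 2 * (Real.exp (X ω ^ 2 / σ ^ 2) - 1))) ∂P
          = 1 + u ^ 2 * σ ^ 2 * (∫ ω, Real.exp (X ω ^ 2 / σ ^ 2) ∂P - 1) := by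
        have hI' : Integrable (fun ω => u ^ 2 * σ ^ 2 * (Real.exp (X ω ^ 2 / σ ^ 2) - 1)) P :=
          (hi.sub (integrable_const _)).const_mul _
        rw [integral_add (hXi.const_mul u) hI, integral_const_mul, h0,
          integral_add (integrable_const _) hI', integral_const_mul,
          integral_sub hi (integrable_const _)]
        simp
      refine h1.trans ((le_of_eq h2).trans ?_)
      have h3 := Real.add_one_le_exp (3 * σ ^ 2 * u ^ 2 / 2)
      nlinarith
    · have h1 : mgf X P u ≤ _ := integral_mono_of_nonneg (ae_of_all _ fun ω => (Real.exp_pos _).le)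
        (hi.const_mul (Real.exp (u ^ 2 * σ ^ 2 / 2))) (ae_of_all _ (young u))
      rw [integral_const_mul] at h1
      have h3 := Real.add_one_le_exp (u ^ 2 * σ ^ 2)
      have h4 : Real.exp (3 * σ ^ 2 * u ^ 2 / 2)
          = Real.exp (u ^ 2 * σ ^ 2 / 2) * Real.exp (u ^ 2 * σ ^ 2) := by
        rw [← Real.exp_add]; congr 1; ring
      rw [h4]
      exact h1.trans (mul_le_mul_of_nonneg_left (by linarith) (Real.exp_pos _).le)

/-- The square of a random variable with `ψ₂`-norm at most `σ` is sub-exponential: its centred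
moment generating function is of Gaussian type near the origin. -/
theorem lintegral_exp_mul_sq_sub_le (hσ : 0 < σ) (hX : Measurable X)
    (h : ∫⁻ ω, ENNReal.ofReal (Real.exp (X ω ^ 2 / σ ^ 2)) ∂P ≤ 2) {u : ℝ}
    (hu : 4 * (σ ^ 2 * |u|) ≤ 1) :
    ∫⁻ ω, ENNReal.ofReal (Real.exp (u * (X ω ^ 2 - ∫ ω', X ω' ^ 2 ∂P))) ∂P
      ≤ ENNReal.ofReal (Real.exp (128 * (u ^ 2 * σ ^ 4))) := by
  have hi := integrable_exp_sq_div hX h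
  have hE := integral_exp_sq_div_le hX h
  have hsq := integrable_sq_of_exp_sq hσ hX h
  have hE1 := integral_sq_div_le_one hσ hX h
  rw [integral_div] at hE1
  set m := ∫ ω', X ω' ^ 2 ∂P with hm
  have hm0 : 0 ≤ m := integral_nonneg fun ω => sq_nonneg _
  have hs : 0 < σ ^ 2 := by positivity
  have hmσ : m ≤ σ ^ 2 := by rwa [div_le_one hs] at hE1
  have hb : ∀ ω, Real.exp (u * (X ω ^ 2 - m))
      ≤ 1 + u * (X ω ^ 2 - m) + 64 * (u ^ 2 * σ ^ 4) * Real.exp (X ω ^ 2 / σ ^ 2) := by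
    intro ω
    set w := X ω ^ 2 / σ ^ 2 with hw
    have hw0 : 0 ≤ w := by positivity
    have hXw : X ω ^ 2 = σ ^ 2 * w := by rw [hw]; field_simp
    set v := m / σ ^ 2 with hv
    have hv0 : 0 ≤ v := by positivity
    have hmv : m = σ ^ 2 * v := by rw [hv]; field_simp
    have hx : u * (X ω ^ 2 - m) = u * σ ^ 2 * (w - v) := by rw [hXw, hmv]; ring
    have h1 := exp_le_one_add_self_add_sq_mul_exp_abs (u * (X ω ^ 2 - m))
    refine h1.trans ?_
    have hd : |w - v| ≤ w + 1 := abs_le.2 ⟨by linarith, by linarith⟩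
    have hax : |u * (X ω ^ 2 - m)| ≤ |w - v| / 4 := by
      rw [hx, abs_mul, abs_mul, abs_of_pos hs]
      nlinarith [abs_nonneg (w - v)]
    -- `y² ≤ 32 exp (y / 4)` absorbs the quadratic factor into the exponential.
    have hy : (w - v) ^ 2 ≤ 32 * Real.exp (|w - v| / 4) := by
      have := Real.quadratic_le_exp_of_nonneg (x := |w - v| / 4) (by positivity)
      nlinarith [sq_abs (w - v), abs_nonneg (w - v)]
    have he : Real.exp (|w - v| / 4) * Real.exp (|w - v| / 4) ≤ 2 * Real.exp w := by
      rw [← Real.exp_add]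
      have h2 : Real.exp (1 / 2) ≤ 2 := by
        have := Real.exp_bound_div_one_sub_of_interval (x := 1 / 2) (by norm_num) (by norm_num)
        norm_num at this ⊢; linarith
      calc Real.exp (|w - v| / 4 + |w - v| / 4) ≤ Real.exp (1 / 2 + w) :=
            Real.exp_le_exp.2 (by linarith)
        _ = Real.exp (1 / 2) * Real.exp w := Real.exp_add _ _
        _ ≤ _ := mul_le_mul_of_nonneg_right h2 (Real.exp_pos _).le
    have hfin : (u * (X ω ^ 2 - m)) ^ 2 * Real.exp |u * (X ω ^ 2 - m)|
        ≤ 64 * (u ^ 2 * σ ^ 4) * Real.exp w := by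
      calc (u * (X ω ^ 2 - m)) ^ 2 * Real.exp |u * (X ω ^ 2 - m)|
          ≤ (u * (X ω ^ 2 - m)) ^ 2 * Real.exp (|w - v| / 4) := by gcongr
        _ = (u ^ 2 * σ ^ 4) * ((w - v) ^ 2 * Real.exp (|w - v| / 4)) := by rw [hx]; ring
        _ ≤ (u ^ 2 * σ ^ 4) * (32 * Real.exp (|w - v| / 4) * Real.exp (|w - v| / 4)) := by gcongr
        _ ≤ (u ^ 2 * σ ^ 4) * (32 * (2 * Real.exp w)) := by
            rw [mul_assoc 32]; gcongr
        _ = _ := by ring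
    linarith
  have hI1 : Integrable (fun ω => 1 + u * (X ω ^ 2 - m)) P :=
    (integrable_const _).add ((hsq.sub (integrable_const _)).const_mul _)
  have hI2 : Integrable (fun ω => 64 * (u ^ 2 * σ ^ 4) * Real.exp (X ω ^ 2 / σ ^ 2)) P :=
    hi.const_mul _
  calc ∫⁻ ω, ENNReal.ofReal (Real.exp (u * (X ω ^ 2 - m))) ∂P
      ≤ ∫⁻ ω, ENNReal.ofReal (1 + u * (X ω ^ 2 - m)
          + 64 * (u ^ 2 * σ ^ 4) * Real.exp (X ω ^ 2 / σ ^ 2)) ∂P :=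
        lintegral_mono fun ω => ENNReal.ofReal_le_ofReal (hb ω)
    _ = ENNReal.ofReal (∫ ω, (1 + u * (X ω ^ 2 - m)
          + 64 * (u ^ 2 * σ ^ 4) * Real.exp (X ω ^ 2 / σ ^ 2)) ∂P) :=
        (ofReal_integral_eq_lintegral_ofReal (hI1.add hI2)
          (ae_of_all _ fun ω => (Real.exp_pos _).le.trans (hb ω))).symm
    _ ≤ _ := by
        refine ENNReal.ofReal_le_ofReal ?_
        have hI3 : Integrable (fun ω => u * (X ω ^ 2 - m)) P :=
          (hsq.sub (integrable_const _)).const_mul _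
        rw [integral_add hI1 hI2, integral_const_mul,
          integral_add (integrable_const _) hI3, integral_const_mul,
          integral_sub hsq (integrable_const _)]
        simp only [integral_const, probReal_univ, smul_eq_mul, one_mul, mul_one, ← hm, sub_self,
          mul_zero, add_zero]
        have h3 := Real.add_one_le_exp (128 * (u ^ 2 * σ ^ 4))
        have h4 : 0 ≤ u ^ 2 * σ ^ 4 := by positivity
        nlinarith

end Orlicz

/-! ### Exponential moments of squares and of decoupled bilinear forms -/

/-- `b` bounds the operator norm of the rectangular matrix `B` for the Euclidean norms. -/
def HasL2Bound {κ ι : Type*} [Fintype κ] [Fintype ι] (B : Matrix κ ι ℝ) (b : ℝ) : Prop :=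
  ∀ x : ι → ℝ, ∑ i, (B.mulVec x i) ^ 2 ≤ b ^ 2 * ∑ j, x j ^ 2

/-- Diagonalization of the quadratic form `|B x|²` in an orthonormal basis, given by the columns of
`U`. -/
theorem exists_diagonalization_sq {κ ι : Type*} [Fintype κ] [Fintype ι]
    (B : Matrix κ ι ℝ) {b : ℝ} (hb : HasL2Bound B b) :
    ∃ (U : Matrix ι ι ℝ) (l : ι → ℝ),
      (∀ x : ι → ℝ, ∑ i, (B.mulVec x i) ^ 2 = ∑ k, l k * (∑ j, U j k * x j) ^ 2) ∧
      (∀ c : ι → ℝ, ∑ j, (∑ k, U j k * c k) ^ 2 = ∑ k, c k ^ 2) ∧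
      (∀ k, 0 ≤ l k) ∧ (∀ k, l k ≤ b ^ 2) ∧ ∑ k, l k = ∑ i, ∑ j, B i j ^ 2 := by
  classical
  have hN : (B.transpose * B).IsHermitian := by
    have := Matrix.isHermitian_conjTranspose_mul_self B
    rwa [Matrix.conjTranspose_eq_transpose_of_trivial] at this
  set U : Matrix ι ι ℝ := (hN.eigenvectorUnitary : Matrix ι ι ℝ) with hU
  have hUU : U.transpose * U = 1 := by
    have := Unitary.coe_star_mul_self hN.eigenvectorUnitary
    rwa [Matrix.star_eq_conjTranspose, Matrix.conjTranspose_eq_transpose_of_trivial] at this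
  have hsp : B.transpose * B = U * Matrix.diagonal hN.eigenvalues * U.transpose := by
    have := hN.spectral_theorem
    rw [Unitary.conjStarAlgAut_apply] at this
    simpa [Matrix.star_eq_conjTranspose, Matrix.conjTranspose_eq_transpose_of_trivial,
      Function.comp_def] using this
  have h1 : ∀ x : ι → ℝ, ∑ i, (B.mulVec x i) ^ 2
      = ∑ k, hN.eigenvalues k * (∑ j, U j k * x j) ^ 2 := by
    intro x
    have e1 : ∑ i, (B.mulVec x i) ^ 2 = x ⬝ᵥ (B.transpose * B).mulVec x := by
      rw [← Matrix.mulVec_mulVec, Matrix.dotProduct_mulVec, Matrix.vecMul_transpose]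
      simp [dotProduct, sq]
    refine e1.trans ((congrArg (fun N : Matrix ι ι ℝ => x ⬝ᵥ N.mulVec x) hsp).trans ?_)
    rw [← Matrix.mulVec_mulVec, ← Matrix.mulVec_mulVec, Matrix.dotProduct_mulVec,
      ← Matrix.mulVec_transpose]
    simp only [dotProduct, Matrix.mulVec_diagonal]
    refine Finset.sum_congr rfl fun k _ => ?_
    simp only [Matrix.mulVec, dotProduct, Matrix.transpose_apply]
    ring
  have h2 : ∀ c : ι → ℝ, ∑ j, (∑ k, U j k * c k) ^ 2 = ∑ k, c k ^ 2 := by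
    intro c
    have e1 : U.mulVec c ⬝ᵥ U.mulVec c = c ⬝ᵥ c := by
      rw [Matrix.dotProduct_mulVec, ← Matrix.mulVec_transpose, Matrix.mulVec_mulVec, hUU,
        Matrix.one_mulVec]
    simpa [dotProduct, Matrix.mulVec, sq] using e1
  -- evaluate the form at the columns of `U`
  have h3 : ∀ k, ∑ i, (B.mulVec (fun j => U j k) i) ^ 2 = hN.eigenvalues k ∧
      ∑ j, U j k ^ 2 = 1 := by
    intro k
    have e : ∀ k', ∑ j, U j k' * U j k = if k' = k then 1 else 0 := by
      intro k'
      have := congrFun (congrFun hUU k') k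
      simpa [Matrix.mul_apply, Matrix.one_apply] using this
    constructor
    · rw [h1]
      simp [e]
    · have := e k
      simpa [sq] using this
  refine ⟨U, hN.eigenvalues, h1, h2, fun k => ?_, fun k => ?_, ?_⟩
  · rw [← (h3 k).1]
    exact Finset.sum_nonneg fun i _ => sq_nonneg _
  · rw [← (h3 k).1]
    refine (hb _).trans ?_
    rw [(h3 k).2, mul_one]
  · have := hN.trace_eq_sum_eigenvalues
    simp only [RCLike.ofReal_real_eq_id, id_eq] at this
    rw [← this, Matrix.trace, Finset.sum_comm]
    refine Finset.sum_congr rfl fun j _ => ?_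
    simp [Matrix.mul_apply, sq]

theorem lintegral_exp_mul_gaussianReal (a : ℝ) :
    ∫⁻ g, ENNReal.ofReal (Real.exp (a * g)) ∂(gaussianReal 0 1)
      = ENNReal.ofReal (Real.exp (a ^ 2 / 2)) := by
  rw [← ofReal_integral_eq_lintegral_ofReal (integrable_exp_mul_gaussianReal a)
    (ae_of_all _ fun _ => (Real.exp_pos _).le)]
  have := mgf_gaussianReal (p := gaussianReal 0 1) (X := id) (μ := 0) (v := 1) (by simp) a
  simp only [mgf, id_eq, zero_mul, zero_add, NNReal.coe_one, one_mul] at this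
  rw [this]

/-- The exact value is `(1 - 2 a)^(-1/2)`. -/
theorem lintegral_exp_mul_sq_gaussianReal_le {a : ℝ} (h0 : 0 ≤ a) (h1 : a ≤ 1 / 4) :
    ∫⁻ g, ENNReal.ofReal (Real.exp (a * g ^ 2)) ∂(gaussianReal 0 1)
      ≤ ENNReal.ofReal (Real.exp (2 * a)) := by
  have hb : 0 < 1 / 2 - a := by linarith
  rw [gaussianReal_of_var_ne_zero _ one_ne_zero, lintegral_withDensity_eq_lintegral_mul _
    (measurable_gaussianPDF 0 1) (by fun_prop)]
  have e : ∀ g : ℝ, (gaussianPDF 0 1 * fun g => ENNReal.ofReal (Real.exp (a * g ^ 2))) g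
      = ENNReal.ofReal ((√(2 * Real.pi))⁻¹ * Real.exp (-(1 / 2 - a) * g ^ 2)) := by
    intro g
    rw [Pi.mul_apply, gaussianPDF, ← ENNReal.ofReal_mul (gaussianPDFReal_nonneg _ _ _),
      gaussianPDFReal]
    simp only [NNReal.coe_one, mul_one, sub_zero]
    rw [mul_assoc, ← Real.exp_add]
    congr 3
    ring
  simp_rw [e]
  rw [← ofReal_integral_eq_lintegral_ofReal ((integrable_exp_neg_mul_sq hb).const_mul _)
    (ae_of_all _ fun _ => by positivity), integral_const_mul, integral_gaussian]
  refine ENNReal.ofReal_le_ofReal ?_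
  rw [inv_mul_le_iff₀ (by positivity)]
  refine Real.sqrt_le_iff.2 ⟨by positivity, ?_⟩
  rw [mul_pow, Real.sq_sqrt (by positivity), div_le_iff₀ hb, ← Real.exp_nat_mul]
  have h2 := Real.add_one_le_exp (((2 : ℕ) : ℝ) * (2 * a))
  push_cast at h2 ⊢
  have h3 : 1 ≤ 2 * (1 / 2 - a) * Real.exp (2 * (2 * a)) := by nlinarith
  nlinarith [Real.pi_pos]

section Independent

variable {Ω : Type*} [MeasurableSpace Ω] {P : Measure Ω} {ι : Type*} [Fintype ι] {X : ι → Ω → ℝ}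

/-- A linear form in independent sub-Gaussian variables is sub-Gaussian. -/
theorem lintegral_exp_sum_le {c : NNReal} (hX : ∀ i, Measurable (X i)) (hind : iIndepFun X P)
    (hc : ∀ i, HasSubgaussianMGF (X i) c P) (a : ι → ℝ) :
    ∫⁻ ω, ENNReal.ofReal (Real.exp (∑ i, a i * X i ω)) ∂P
      ≤ ENNReal.ofReal (Real.exp (c / 2 * ∑ i, a i ^ 2)) := by
  have h := lintegral_prod_eq_prod_lintegral_of_indepFun Finset.univ
    (fun i ω => ENNReal.ofReal (Real.exp (a i * X i ω)))
    (hind.comp (fun i x => ENNReal.ofReal (Real.exp (a i * x))) (fun i => by fun_prop))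
    (fun i => by have := hX i; fun_prop)
  simp_rw [Real.exp_sum, ENNReal.ofReal_prod_of_nonneg (fun i _ => (Real.exp_pos _).le)]
  rw [h, Finset.mul_sum, Real.exp_sum,
    ENNReal.ofReal_prod_of_nonneg (fun i _ => (Real.exp_pos _).le)]
  refine Finset.prod_le_prod' fun i _ => ?_
  rw [← ofReal_integral_eq_lintegral_ofReal ((hc i).integrable_exp_mul _)
    (ae_of_all _ fun _ => (Real.exp_pos _).le)]
  refine ENNReal.ofReal_le_ofReal (((hc i).mgf_le (a i)).trans (le_of_eq ?_))
  congr 1; ring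

/-- Exponential moments of `|B X|²`. The square is linearized by an auxiliary Gaussian vector, after
which the expectation over `X` is that of a linear form. -/
theorem lintegral_exp_sq_norm_le [IsProbabilityMeasure P] {κ : Type*} [Fintype κ] {c : NNReal}
    (hX : ∀ i, Measurable (X i))
    (hind : iIndepFun X P) (hc : ∀ i, HasSubgaussianMGF (X i) c P) (B : Matrix κ ι ℝ) {b μ : ℝ}
    (hb : HasL2Bound B b) (hμ : 0 ≤ μ) (hμb : 4 * (c * μ * b ^ 2) ≤ 1) :
    ∫⁻ ω, ENNReal.ofReal (Real.exp (μ * ∑ i, (B.mulVec (fun j => X j ω) i) ^ 2)) ∂P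
      ≤ ENNReal.ofReal (Real.exp (2 * c * μ * ∑ i, ∑ j, B i j ^ 2)) := by
  obtain ⟨U, l, hl, hU, hl0, hlb, htr⟩ := exists_diagonalization_sq B hb
  let Γ : Measure (ι → ℝ) := Measure.pi fun _ => gaussianReal 0 1
  have hΓ : iIndepFun (fun (k : ι) (g : ι → ℝ) => g k) Γ :=
    iIndepFun_pi (X := fun _ => id) (fun _ => aemeasurable_id)
  have hmarg : ∀ (k : ι) (f : ℝ → ℝ≥0∞), Measurable f →
      ∫⁻ g, f (g k) ∂Γ = ∫⁻ x, f x ∂(gaussianReal 0 1) := fun k f hf =>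
    (measurePreserving_eval (fun _ : ι => gaussianReal 0 1) k).lintegral_comp hf
  have hΓprod : ∀ f : ι → ℝ → ℝ≥0∞, (∀ k, Measurable (f k)) →
      ∫⁻ g, ∏ k, f k (g k) ∂Γ = ∏ k, ∫⁻ x, f k x ∂(gaussianReal 0 1) := by
    intro f hf
    have := lintegral_prod_eq_prod_lintegral_of_indepFun Finset.univ
      (fun k (g : ι → ℝ) => f k (g k)) (hΓ.comp f hf)
      (fun k => (hf k).comp (measurable_pi_apply k))
    rw [this]
    exact Finset.prod_congr rfl fun k _ => hmarg k (f k) (hf k)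
  set s : ι → ℝ := fun k => √(2 * μ * l k) with hs
  have hs2 : ∀ k, s k ^ 2 = 2 * μ * l k := fun k =>
    Real.sq_sqrt (mul_nonneg (by positivity) (hl0 k))
  -- linearization
  have hlin : ∀ ω, ENNReal.ofReal (Real.exp (μ * ∑ i, (B.mulVec (fun j => X j ω) i) ^ 2))
      = ∫⁻ g, ENNReal.ofReal (Real.exp (∑ j, (∑ k, U j k * (s k * g k)) * X j ω)) ∂Γ := by
    intro ω
    have e1 : μ * ∑ i, (B.mulVec (fun j => X j ω) i) ^ 2
        = ∑ k, (s k * ∑ j, U j k * X j ω) ^ 2 / 2 := by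
      rw [hl, Finset.mul_sum]
      refine Finset.sum_congr rfl fun k _ => ?_
      rw [mul_pow, hs2]; ring
    have e2 : ∀ g : ι → ℝ, ENNReal.ofReal (Real.exp (∑ j, (∑ k, U j k * (s k * g k)) * X j ω))
        = ∏ k, ENNReal.ofReal (Real.exp ((s k * ∑ j, U j k * X j ω) * g k)) := by
      intro g
      rw [← ENNReal.ofReal_prod_of_nonneg (fun i _ => (Real.exp_pos _).le), ← Real.exp_sum]
      congr 2
      simp_rw [Finset.sum_mul, Finset.mul_sum, Finset.sum_mul]
      rw [Finset.sum_comm]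
      exact Finset.sum_congr rfl fun k _ => Finset.sum_congr rfl fun j _ => by ring
    simp_rw [e2]
    rw [hΓprod (fun k x => ENNReal.ofReal (Real.exp ((s k * ∑ j, U j k * X j ω) * x)))
      (fun k => by fun_prop), e1, Real.exp_sum,
      ENNReal.ofReal_prod_of_nonneg (fun i _ => (Real.exp_pos _).le)]
    exact Finset.prod_congr rfl fun k _ => (lintegral_exp_mul_gaussianReal _).symm
  simp_rw [hlin]
  rw [lintegral_lintegral_swap (by
    have : Measurable fun q : Ω × (ι → ℝ) =>
        ENNReal.ofReal (Real.exp (∑ j, (∑ k, U j k * (s k * q.2 k)) * X j q.1)) := by fun_prop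
    exact this.aemeasurable)]
  have hsum : ∀ g : ι → ℝ, (c : ℝ) / 2 * ∑ j, (∑ k, U j k * (s k * g k)) ^ 2
      = ∑ k, c * μ * l k * g k ^ 2 := by
    intro g
    rw [hU, Finset.mul_sum]
    refine Finset.sum_congr rfl fun k _ => ?_
    rw [mul_pow, hs2]; ring
  calc ∫⁻ g, ∫⁻ ω, ENNReal.ofReal (Real.exp (∑ j, (∑ k, U j k * (s k * g k)) * X j ω)) ∂P ∂Γ
      ≤ ∫⁻ g, ENNReal.ofReal (Real.exp (∑ k, c * μ * l k * g k ^ 2)) ∂Γ := by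
        refine lintegral_mono fun g => ?_
        rw [← hsum]
        exact lintegral_exp_sum_le hX hind hc _
    _ = ∏ k, ∫⁻ x, ENNReal.ofReal (Real.exp (c * μ * l k * x ^ 2)) ∂(gaussianReal 0 1) := by
        rw [← hΓprod (fun k x => ENNReal.ofReal (Real.exp (c * μ * l k * x ^ 2)))
          (fun k => by fun_prop)]
        refine lintegral_congr fun g => ?_
        rw [Real.exp_sum, ENNReal.ofReal_prod_of_nonneg (fun i _ => (Real.exp_pos _).le)]
    _ ≤ ∏ k, ENNReal.ofReal (Real.exp (2 * (c * μ * l k))) := by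
        refine Finset.prod_le_prod' fun k _ => lintegral_exp_mul_sq_gaussianReal_le ?_ ?_
        · exact mul_nonneg (by positivity) (hl0 k)
        · have := mul_le_mul_of_nonneg_left (hlb k) (show (0 : ℝ) ≤ c * μ by positivity)
          linarith
    _ = _ := by
        rw [← ENNReal.ofReal_prod_of_nonneg (fun i _ => (Real.exp_pos _).le), ← Real.exp_sum,
          ← htr, Finset.mul_sum]
        congr 2
        exact Finset.sum_congr rfl fun k _ => by ring

/-- Tonelli's theorem for a function of two independent random variables. -/
theorem lintegral_comp_indepFun [IsProbabilityMeasure P] {α β : Type*} [MeasurableSpace α]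
    [MeasurableSpace β] {V : Ω → α} {W : Ω → β} (hV : Measurable V) (hW : Measurable W)
    (h : IndepFun V W P) {F : α × β → ℝ≥0∞} (hF : Measurable F) :
    ∫⁻ ω, F (V ω, W ω) ∂P = ∫⁻ ω', ∫⁻ ω, F (V ω, W ω') ∂P ∂P := by
  have := (indepFun_iff_map_prod_eq_prod_map_map hV.aemeasurable hW.aemeasurable).1 h
  have : IsProbabilityMeasure (P.map V) := Measure.isProbabilityMeasure_map hV.aemeasurable
  have : IsProbabilityMeasure (P.map W) := Measure.isProbabilityMeasure_map hW.aemeasurable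
  rw [← lintegral_map hF (hV.prodMk hW), ‹P.map _ = _›, lintegral_prod_symm _ hF.aemeasurable,
    lintegral_map hF.lintegral_prod_left' hW]
  refine lintegral_congr fun ω' => ?_
  exact lintegral_map (f := fun x => F (x, W ω')) (hF.comp measurable_prodMk_right) hV

/-- The decoupled bilinear form, between the variables indexed by `I` and those indexed by its
complement. -/
theorem lintegral_exp_bilinear_le [IsProbabilityMeasure P] [DecidableEq ι] {c : NNReal}
    (hX : ∀ i, Measurable (X i))
    (hind : iIndepFun X P) (hc : ∀ i, HasSubgaussianMGF (X i) c P) (M : Matrix ι ι ℝ) {b θ : ℝ}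
    (hb : HasL2Bound M b) (hθ : 2 * ((c : ℝ) ^ 2 * θ ^ 2 * b ^ 2) ≤ 1) (I : Finset ι) :
    ∫⁻ ω, ENNReal.ofReal (Real.exp (θ * ∑ i, ∑ j,
        if i ∈ I ∧ j ∉ I then M i j * (X i ω * X j ω) else 0)) ∂P
      ≤ ENNReal.ofReal (Real.exp ((c : ℝ) ^ 2 * θ ^ 2 * ∑ i, ∑ j, M i j ^ 2)) := by
  let V : Ω → ι → ℝ := fun ω i => if i ∈ I then X i ω else 0
  let W : Ω → ι → ℝ := fun ω i => if i ∈ I then 0 else X i ω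
  have hV : Measurable V := measurable_pi_lambda _ fun i => by
    by_cases h : i ∈ I <;> simp [V, h, hX i]
  have hW : Measurable W := measurable_pi_lambda _ fun i => by
    by_cases h : i ∈ I <;> simp [W, h, hX i]
  have hVW : IndepFun V W P := by
    have h := hind.indepFun_finset I Iᶜ disjoint_compl_right hX
    have h1 := h.comp (φ := fun (v : I → ℝ) (i : ι) => if h : i ∈ I then v ⟨i, h⟩ else 0)
      (ψ := fun (v : (Iᶜ : Finset ι) → ℝ) (i : ι) => if h : i ∈ Iᶜ then v ⟨i, h⟩ else 0)
      (measurable_pi_lambda _ fun i => by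
        by_cases h : i ∈ I <;> simp only [h, dite_true, dite_false] <;> fun_prop)
      (measurable_pi_lambda _ fun i => by
        by_cases h : i ∈ Iᶜ <;> simp only [h, dite_true, dite_false] <;> fun_prop)
    convert h1 using 1
    · ext ω i
      by_cases h : i ∈ I <;> simp [V, h]
    · ext ω i
      by_cases h : i ∈ I <;> simp [W, h]
  have e1 : ∀ ω, (∑ i, ∑ j, if i ∈ I ∧ j ∉ I then M i j * (X i ω * X j ω) else 0)
      = ∑ i, M.mulVec (W ω) i * V ω i := by
    intro ω
    refine Finset.sum_congr rfl fun i _ => ?_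
    simp only [Matrix.mulVec, dotProduct, Finset.sum_mul]
    refine Finset.sum_congr rfl fun j _ => ?_
    by_cases h1 : i ∈ I <;> by_cases h2 : j ∈ I <;> simp [V, W, h1, h2]
    ring
  simp_rw [e1]
  let F : (ι → ℝ) × (ι → ℝ) → ℝ≥0∞ := fun q =>
    ENNReal.ofReal (Real.exp (θ * ∑ i, M.mulVec q.2 i * q.1 i))
  have hF : Measurable F := by
    simp only [F, Matrix.mulVec, dotProduct]
    fun_prop
  refine (le_of_eq (lintegral_comp_indepFun hV hW hVW hF)).trans ?_
  let B : Matrix ι ι ℝ := Matrix.of fun i j => if j ∈ I then 0 else M i j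
  have hBW : ∀ ω, M.mulVec (W ω) = B.mulVec (fun j => X j ω) := by
    intro ω
    ext i
    simp only [Matrix.mulVec, dotProduct, B, W, Matrix.of_apply]
    exact Finset.sum_congr rfl fun j _ => by by_cases h : j ∈ I <;> simp [h]
  have hB : HasL2Bound B b := by
    intro x
    have e : B.mulVec x = M.mulVec (fun j => if j ∈ I then 0 else x j) := by
      ext i
      simp only [Matrix.mulVec, dotProduct, B, Matrix.of_apply]
      exact Finset.sum_congr rfl fun j _ => by by_cases h : j ∈ I <;> simp [h]
    rw [e]
    refine (hb _).trans (mul_le_mul_of_nonneg_left (Finset.sum_le_sum fun j _ => ?_) (sq_nonneg b))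
    by_cases h : j ∈ I <;> simp [h, sq_nonneg]
  calc ∫⁻ ω', ∫⁻ ω, F (V ω, W ω') ∂P ∂P
      ≤ ∫⁻ ω', ENNReal.ofReal (Real.exp (c * θ ^ 2 / 2
          * ∑ i, (B.mulVec (fun j => X j ω') i) ^ 2)) ∂P := by
        refine lintegral_mono fun ω' => ?_
        have h := lintegral_exp_sum_le hX hind hc
          (fun i => if i ∈ I then θ * M.mulVec (W ω') i else 0)
        refine le_trans (le_of_eq (lintegral_congr fun ω => ?_)) (h.trans ?_)
        · simp only [F]
          congr 2
          rw [Finset.mul_sum]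
          exact Finset.sum_congr rfl fun i _ => by by_cases h : i ∈ I <;> simp [V, h]; ring
        · refine ENNReal.ofReal_le_ofReal (Real.exp_le_exp.2 ?_)
          rw [← hBW, show (c : ℝ) * θ ^ 2 / 2 * ∑ i, M.mulVec (W ω') i ^ 2
            = c / 2 * ∑ i, (θ * M.mulVec (W ω') i) ^ 2 by
              simp_rw [mul_pow, ← Finset.mul_sum]; ring]
          refine mul_le_mul_of_nonneg_left (Finset.sum_le_sum fun i _ => ?_) (by positivity)
          by_cases h : i ∈ I <;> simp [h]
          positivity
    _ ≤ ENNReal.ofReal (Real.exp (2 * c * (c * θ ^ 2 / 2) * ∑ i, ∑ j, B i j ^ 2)) :=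
        lintegral_exp_sq_norm_le hX hind hc B hB (by positivity) (by linarith)
    _ ≤ _ := by
        refine ENNReal.ofReal_le_ofReal (Real.exp_le_exp.2 ?_)
        rw [show 2 * (c : ℝ) * (c * θ ^ 2 / 2) = (c : ℝ) ^ 2 * θ ^ 2 by ring]
        refine mul_le_mul_of_nonneg_left (Finset.sum_le_sum fun i _ => Finset.sum_le_sum
          fun j _ => ?_) (by positivity)
        by_cases h : j ∈ I <;> simp [B, h, sq_nonneg]

end Independent

/-! ### Decoupling and the Hanson–Wright inequality -/

section HansonWright

variable {ι : Type*} [Fintype ι]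

/-- A random subset separates two given points, in a given order, with probability `1/4`. -/
theorem four_mul_sum_mem_notMem [DecidableEq ι] {i j : ι} (hij : i ≠ j) :
    4 * ∑ I : Finset ι, (if i ∈ I ∧ j ∉ I then (1 : ℝ) else 0) = 2 ^ Fintype.card ι := by
  -- expand a product of sums with factors that vanish unless `i ∈ I` and `j ∉ I`
  have h := Finset.prod_add (fun k => if k = j then (0 : ℝ) else 1)
    (fun k => if k = i then (0 : ℝ) else 1) Finset.univ
  have e1 : ∀ I : Finset ι, (∏ k ∈ I, if k = j then (0 : ℝ) else 1)
      * (∏ k ∈ Finset.univ \ I, if k = i then (0 : ℝ) else 1)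
      = if i ∈ I ∧ j ∉ I then (1 : ℝ) else 0 := by
    intro I
    have e : ∀ (S : Finset ι) (l : ι), (∏ k ∈ S, if k = l then (0 : ℝ) else 1)
        = if l ∈ S then 0 else 1 := by
      intro S l
      split_ifs with h
      · exact Finset.prod_eq_zero h (if_pos rfl)
      · exact Finset.prod_eq_one fun k hk => if_neg (by rintro rfl; exact h hk)
    rw [e, e]
    by_cases h1 : i ∈ I <;> by_cases h2 : j ∈ I <;> simp [h1, h2]
  rw [Finset.powerset_univ] at h
  simp_rw [e1] at h
  rw [← h]
  have e2 : (4 : ℝ)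
      = (∏ k : ι, if k = i then (2 : ℝ) else 1) * ∏ k : ι, if k = j then (2 : ℝ) else 1 := by
    norm_num [Finset.prod_ite_eq']
  rw [e2, ← Finset.prod_mul_distrib, ← Finset.prod_mul_distrib, Fintype.card,
    ← Finset.prod_const]
  refine Finset.prod_congr rfl fun k _ => ?_
  by_cases h1 : k = i
  · subst h1; simp [hij]
  · by_cases h2 : k = j
    · subst h2; simp [h1]
    · simp only [h1, h2, if_false]; norm_num

/-- Decoupling: the off-diagonal part of a quadratic form is four times the average over all `I` of
the bilinear form between the coordinates in `I` and the others; then use convexity of `exp`. -/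
theorem exp_offDiag_le [DecidableEq ι] (M : Matrix ι ι ℝ) (x : ι → ℝ) (u : ℝ) :
    Real.exp (u * ∑ i, ∑ j, if i = j then 0 else M i j * (x i * x j)) ≤
      ∑ I : Finset ι, ((2 : ℝ) ^ Fintype.card ι)⁻¹ * Real.exp (4 * u * ∑ i, ∑ j,
        if i ∈ I ∧ j ∉ I then M i j * (x i * x j) else 0) := by
  have hw : ∑ _I : Finset ι, ((2 : ℝ) ^ Fintype.card ι)⁻¹ = 1 := by
    simp
  have hconv := convexOn_exp.map_sum_le (t := (Finset.univ : Finset (Finset ι)))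
    (w := fun _ => ((2 : ℝ) ^ Fintype.card ι)⁻¹)
    (p := fun I => 4 * u * ∑ i, ∑ j, if i ∈ I ∧ j ∉ I then M i j * (x i * x j) else 0)
    (fun _ _ => by positivity) hw (fun _ _ => Set.mem_univ _)
  simp only [smul_eq_mul] at hconv
  refine le_of_eq_of_le ?_ hconv
  congr 1
  rw [← Finset.mul_sum, ← Finset.mul_sum]
  have e : ∀ i j : ι, 4 * ∑ I : Finset ι, (if i ∈ I ∧ j ∉ I then M i j * (x i * x j) else 0)
      = 2 ^ Fintype.card ι * if i = j then 0 else M i j * (x i * x j) := by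
    intro i j
    by_cases hij : i = j
    · subst hij
      simp
    · rw [← four_mul_sum_mem_notMem hij, if_neg hij, mul_assoc, Finset.sum_mul]
      simp
  have e' : 4 * ∑ I : Finset ι, ∑ i, ∑ j, (if i ∈ I ∧ j ∉ I then M i j * (x i * x j) else 0)
      = 2 ^ Fintype.card ι * ∑ i, ∑ j, if i = j then 0 else M i j * (x i * x j) := by
    rw [Finset.sum_comm, Finset.mul_sum, Finset.mul_sum]
    refine Finset.sum_congr rfl fun i _ => ?_
    rw [Finset.sum_comm, Finset.mul_sum, Finset.mul_sum]
    exact Finset.sum_congr rfl fun j _ => e i j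
  have h2 : ((2 : ℝ) ^ Fintype.card ι) ≠ 0 := by positivity
  rw [show ∀ s : ℝ, 4 * u * s = u * (4 * s) from fun s => by ring, e']
  field_simp

theorem HasL2Bound.sq_apply_le [DecidableEq ι] {κ : Type*} [Fintype κ] {M : Matrix κ ι ℝ} {b : ℝ}
    (hb : HasL2Bound M b) (i : κ) (j : ι) : M i j ^ 2 ≤ b ^ 2 := by
  have h := hb (Pi.single j 1)
  have e : ∑ k, (Pi.single j 1 : ι → ℝ) k ^ 2 = 1 := by
    simp [Pi.single_apply]
  rw [e, mul_one] at h
  refine le_trans ?_ h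
  have := Finset.single_le_sum (f := fun i => (M.mulVec (Pi.single j 1) i) ^ 2)
    (fun _ _ => sq_nonneg _) (Finset.mem_univ i)
  simpa using this

variable {Ω : Type*} [MeasurableSpace Ω] {P : Measure Ω}
  {X : ι → Ω → ℝ} {σ : ℝ}

/-- The diagonal part of a quadratic form: a sum of independent centred squares. -/
theorem lintegral_exp_diag_le [IsProbabilityMeasure P] (hσ : 0 < σ)
    (hX : ∀ i, Measurable (X i)) (hind : iIndepFun X P)
    (hψ : ∀ i, ∫⁻ ω, ENNReal.ofReal (Real.exp (X i ω ^ 2 / σ ^ 2)) ∂P ≤ 2) (a : ι → ℝ)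
    (ha : ∀ i, 4 * (σ ^ 2 * |a i|) ≤ 1) :
    ∫⁻ ω, ENNReal.ofReal (Real.exp (∑ i, a i * (X i ω ^ 2 - ∫ ω', X i ω' ^ 2 ∂P))) ∂P
      ≤ ENNReal.ofReal (Real.exp (128 * σ ^ 4 * ∑ i, a i ^ 2)) := by
  have h := lintegral_prod_eq_prod_lintegral_of_indepFun Finset.univ
    (fun i ω => ENNReal.ofReal (Real.exp (a i * (X i ω ^ 2 - ∫ ω', X i ω' ^ 2 ∂P))))
    (hind.comp (fun i x => ENNReal.ofReal (Real.exp (a i * (x ^ 2 - ∫ ω', X i ω' ^ 2 ∂P))))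
      (fun i => by fun_prop))
    (fun i => by have := hX i; fun_prop)
  simp_rw [Real.exp_sum, ENNReal.ofReal_prod_of_nonneg (fun i _ => (Real.exp_pos _).le)]
  rw [h, Finset.mul_sum, Real.exp_sum,
    ENNReal.ofReal_prod_of_nonneg (fun i _ => (Real.exp_pos _).le)]
  refine Finset.prod_le_prod' fun i _ => ?_
  refine (lintegral_exp_mul_sq_sub_le hσ (hX i) (hψ i) (ha i)).trans (le_of_eq ?_)
  congr 2; ring

/-- The **Hanson–Wright inequality**, as a bound on the moment generating function of a centred
quadratic form in independent centred sub-Gaussian variables. -/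
theorem lintegral_exp_quadratic_le [IsProbabilityMeasure P] [DecidableEq ι] (hσ : 0 < σ)
    (hX : ∀ i, Measurable (X i))
    (hind : iIndepFun X P) (h0 : ∀ i, ∫ ω, X i ω ∂P = 0)
    (hψ : ∀ i, ∫⁻ ω, ENNReal.ofReal (Real.exp (X i ω ^ 2 / σ ^ 2)) ∂P ≤ 2) (M : Matrix ι ι ℝ)
    {b u : ℝ} (hb0 : 0 ≤ b) (hb : HasL2Bound M b) (hu : 40 * (σ ^ 2 * |u| * b) ≤ 1) :
    ∫⁻ ω, ENNReal.ofReal (Real.exp (u * (∑ i, ∑ j, M i j * (X i ω * X j ω)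
        - ∑ i, M i i * ∫ ω', X i ω' ^ 2 ∂P))) ∂P
      ≤ ENNReal.ofReal (Real.exp (600 * σ ^ 4 * u ^ 2 * ∑ i, ∑ j, M i j ^ 2)) := by
  set F := ∑ i, ∑ j, M i j ^ 2 with hF
  have hF0 : 0 ≤ F := Finset.sum_nonneg fun _ _ => Finset.sum_nonneg fun _ _ => sq_nonneg _
  set c : NNReal := ⟨3 * σ ^ 2, by positivity⟩ with hc
  have hcσ : (c : ℝ) = 3 * σ ^ 2 := rfl
  have hsub : ∀ i, HasSubgaussianMGF (X i) c P := fun i =>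
    hasSubgaussianMGF_of_exp_sq hσ (hX i) (hψ i) (h0 i)
  -- convexity separates the diagonal and off-diagonal parts at the cost of a factor 2 in `u`,
  -- decoupling costs a factor 4: the constants are `128 * 2²` and `(3 * 2 * 4)²`
  have hbound : ENNReal.ofReal (Real.exp (576 * σ ^ 4 * u ^ 2 * F))
      ≤ ENNReal.ofReal (Real.exp (600 * σ ^ 4 * u ^ 2 * F)) := by
    refine ENNReal.ofReal_le_ofReal (Real.exp_le_exp.2 ?_)
    have : 0 ≤ σ ^ 4 * u ^ 2 * F := by positivity
    nlinarith
  let D : Ω → ℝ := fun ω => ∑ i, (2 * u * M i i) * (X i ω ^ 2 - ∫ ω', X i ω' ^ 2 ∂P)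
  let O : Ω → ℝ := fun ω => ∑ i, ∑ j, if i = j then 0 else M i j * (X i ω * X j ω)
  have hD : ∫⁻ ω, ENNReal.ofReal (Real.exp (D ω)) ∂P
      ≤ ENNReal.ofReal (Real.exp (600 * σ ^ 4 * u ^ 2 * F)) := by
    refine (lintegral_exp_diag_le hσ hX hind hψ (fun i => 2 * u * M i i) fun i => ?_).trans ?_
    · have h1 : |M i i| ≤ b := abs_le_of_sq_le_sq (hb.sq_apply_le i i) hb0
      rw [abs_mul, abs_mul, abs_two]
      have h2 : σ ^ 2 * |u| * |M i i| ≤ σ ^ 2 * |u| * b := by gcongr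
      have h3 : 0 ≤ σ ^ 2 * |u| * b := by positivity
      linarith
    · refine ENNReal.ofReal_le_ofReal (Real.exp_le_exp.2 ?_)
      have h1 : ∑ i, M i i ^ 2 ≤ F := Finset.sum_le_sum fun i _ =>
        Finset.single_le_sum (f := fun j => M i j ^ 2) (fun _ _ => sq_nonneg _) (Finset.mem_univ i)
      have h2 : ∑ i, (2 * u * M i i) ^ 2 = 4 * u ^ 2 * ∑ i, M i i ^ 2 := by
        simp_rw [mul_pow, ← Finset.mul_sum]; norm_num
      rw [h2]
      have h3 : 0 ≤ σ ^ 4 * u ^ 2 := by positivity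
      nlinarith [mul_le_mul_of_nonneg_left h1 h3, mul_nonneg h3 hF0]
  have hO : ∫⁻ ω, ENNReal.ofReal (Real.exp (2 * u * O ω)) ∂P
      ≤ ENNReal.ofReal (Real.exp (600 * σ ^ 4 * u ^ 2 * F)) := by
    have hθ : 2 * ((c : ℝ) ^ 2 * (4 * (2 * u)) ^ 2 * b ^ 2) ≤ 1 := by
      have h1 : (40 * (σ ^ 2 * |u| * b)) ^ 2 ≤ 1 := pow_le_one₀ (by positivity) hu
      rw [hcσ]
      have h2 : (σ ^ 2 * |u| * b) ^ 2 = σ ^ 4 * u ^ 2 * b ^ 2 := by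
        rw [mul_pow, mul_pow, sq_abs]; ring
      have h3 : 0 ≤ σ ^ 4 * u ^ 2 * b ^ 2 := by positivity
      rw [mul_pow, h2] at h1
      nlinarith
    calc ∫⁻ ω, ENNReal.ofReal (Real.exp (2 * u * O ω)) ∂P
        ≤ ∫⁻ ω, ∑ I : Finset ι, ENNReal.ofReal (((2 : ℝ) ^ Fintype.card ι)⁻¹)
            * ENNReal.ofReal (Real.exp (4 * (2 * u) * ∑ i, ∑ j,
              if i ∈ I ∧ j ∉ I then M i j * (X i ω * X j ω) else 0)) ∂P := by
          refine lintegral_mono fun ω => ?_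
          refine (ENNReal.ofReal_le_ofReal (exp_offDiag_le M (fun i => X i ω) (2 * u))).trans ?_
          rw [ENNReal.ofReal_sum_of_nonneg (fun I _ => by positivity)]
          exact Finset.sum_le_sum fun I _ => (ENNReal.ofReal_mul (by positivity)).le
      _ = ∑ I : Finset ι, ENNReal.ofReal (((2 : ℝ) ^ Fintype.card ι)⁻¹)
            * ∫⁻ ω, ENNReal.ofReal (Real.exp (4 * (2 * u) * ∑ i, ∑ j,
              if i ∈ I ∧ j ∉ I then M i j * (X i ω * X j ω) else 0)) ∂P := by
          have hm : ∀ I : Finset ι, Measurable fun ω => ENNReal.ofReal (Real.exp (4 * (2 * u)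
              * ∑ i, ∑ j, if i ∈ I ∧ j ∉ I then M i j * (X i ω * X j ω) else 0)) := by
            intro I
            refine (Real.measurable_exp.comp (Measurable.const_mul ?_ _)).ennreal_ofReal
            refine Finset.measurable_sum _ fun i _ => Finset.measurable_sum _ fun j _ => ?_
            split_ifs
            · exact ((hX i).mul (hX j)).const_mul _
            · exact measurable_const
          rw [lintegral_finsetSum _ fun I _ => (hm I).const_mul _]
          exact Finset.sum_congr rfl fun I _ => lintegral_const_mul _ (hm I)
      _ ≤ ∑ I : Finset ι, ENNReal.ofReal (((2 : ℝ) ^ Fintype.card ι)⁻¹)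
            * ENNReal.ofReal (Real.exp (576 * σ ^ 4 * u ^ 2 * F)) := by
          refine Finset.sum_le_sum fun I _ => mul_le_mul_right ?_ _
          refine (lintegral_exp_bilinear_le hX hind hsub M hb hθ I).trans (le_of_eq ?_)
          rw [hcσ, ← hF]
          congr 2; ring
      _ = ENNReal.ofReal (Real.exp (576 * σ ^ 4 * u ^ 2 * F)) := by
          rw [← Finset.sum_mul, ← ENNReal.ofReal_sum_of_nonneg (fun I _ => by positivity)]
          simp
      _ ≤ _ := hbound
  have hmid : ∀ ω, Real.exp (u * (∑ i, ∑ j, M i j * (X i ω * X j ω)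
        - ∑ i, M i i * ∫ ω', X i ω' ^ 2 ∂P))
      ≤ (1 / 2) * Real.exp (D ω) + (1 / 2) * Real.exp (2 * u * O ω) := by
    intro ω
    have e : u * (∑ i, ∑ j, M i j * (X i ω * X j ω) - ∑ i, M i i * ∫ ω', X i ω' ^ 2 ∂P)
        = (1 / 2) * D ω + (1 / 2) * (2 * u * O ω) := by
      have e1 : ∑ i, ∑ j, M i j * (X i ω * X j ω) = ∑ i, M i i * X i ω ^ 2 + O ω := by
        rw [← Finset.sum_add_distrib]
        refine Finset.sum_congr rfl fun i _ => ?_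
        rw [← Finset.add_sum_erase _ _ (Finset.mem_univ i),
          ← Finset.add_sum_erase _ (fun j => if i = j then 0 else M i j * (X i ω * X j ω))
            (Finset.mem_univ i), if_pos rfl, zero_add, sq]
        congr 1
        exact Finset.sum_congr rfl fun j hj => by rw [if_neg (Finset.ne_of_mem_erase hj).symm]
      have e2 : D ω = 2 * u * (∑ i, M i i * X i ω ^ 2 - ∑ i, M i i * ∫ ω', X i ω' ^ 2 ∂P) := by
        rw [← Finset.sum_sub_distrib, Finset.mul_sum]
        exact Finset.sum_congr rfl fun i _ => by ring
      rw [e1, e2]; ring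
    rw [e]
    have := convexOn_exp.2 (Set.mem_univ (D ω)) (Set.mem_univ (2 * u * O ω))
      (show (0 : ℝ) ≤ 1 / 2 by norm_num) (show (0 : ℝ) ≤ 1 / 2 by norm_num) (by norm_num)
    simpa using this
  have hDm : Measurable fun ω => ENNReal.ofReal (Real.exp (D ω)) := by
    simp only [D]; fun_prop
  have hOm : Measurable fun ω => ENNReal.ofReal (Real.exp (2 * u * O ω)) := by
    refine (Real.measurable_exp.comp (Measurable.const_mul ?_ _)).ennreal_ofReal
    refine Finset.measurable_sum _ fun i _ => Finset.measurable_sum _ fun j _ => ?_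
    split_ifs
    · exact measurable_const
    · exact ((hX i).mul (hX j)).const_mul _
  calc _ ≤ ∫⁻ ω, (ENNReal.ofReal (1 / 2) * ENNReal.ofReal (Real.exp (D ω))
          + ENNReal.ofReal (1 / 2) * ENNReal.ofReal (Real.exp (2 * u * O ω))) ∂P := by
        refine lintegral_mono fun ω => (ENNReal.ofReal_le_ofReal (hmid ω)).trans (le_of_eq ?_)
        rw [ENNReal.ofReal_add (by positivity) (by positivity), ENNReal.ofReal_mul (by norm_num),
          ENNReal.ofReal_mul (by norm_num)]
    _ = ENNReal.ofReal (1 / 2) * ∫⁻ ω, ENNReal.ofReal (Real.exp (D ω)) ∂P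
          + ENNReal.ofReal (1 / 2) * ∫⁻ ω, ENNReal.ofReal (Real.exp (2 * u * O ω)) ∂P := by
        rw [lintegral_add_left (hDm.const_mul _), lintegral_const_mul _ hDm,
          lintegral_const_mul _ hOm]
    _ ≤ ENNReal.ofReal (1 / 2) * ENNReal.ofReal (Real.exp (600 * σ ^ 4 * u ^ 2 * F))
          + ENNReal.ofReal (1 / 2) * ENNReal.ofReal (Real.exp (600 * σ ^ 4 * u ^ 2 * F)) := by
        gcongr
    _ = _ := by
        rw [← add_mul, ← ENNReal.ofReal_add (by norm_num) (by norm_num)]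
        norm_num

/-- The expectation of a quadratic form in independent centred variables. -/
theorem integral_quadratic (hσ : 0 < σ) (hX : ∀ i, Measurable (X i))
    (hind : iIndepFun X P) (h0 : ∀ i, ∫ ω, X i ω ∂P = 0)
    (hψ : ∀ i, ∫⁻ ω, ENNReal.ofReal (Real.exp (X i ω ^ 2 / σ ^ 2)) ∂P ≤ 2) (M : Matrix ι ι ℝ) :
    ∫ ω, ∑ i, ∑ j, M i j * (X i ω * X j ω) ∂P = ∑ i, M i i * ∫ ω', X i ω' ^ 2 ∂P := by
  have hint : ∀ i j, Integrable (fun ω => X i ω * X j ω) P := fun i j =>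
    (memLp_two_of_exp_sq hσ (hX i) (hψ i)).integrable_mul (memLp_two_of_exp_sq hσ (hX j) (hψ j))
  refine (integral_finsetSum Finset.univ (f := fun i ω => ∑ j, M i j * (X i ω * X j ω))
    fun i _ => integrable_finsetSum _ fun j _ => (hint i j).const_mul _).trans ?_
  refine Finset.sum_congr rfl fun i _ => ?_
  refine (integral_finsetSum Finset.univ (f := fun j ω => M i j * (X i ω * X j ω))
    fun j _ => (hint i j).const_mul _).trans ?_
  rw [Finset.sum_eq_single i]
  · rw [integral_const_mul]
    simp_rw [sq]
  · intro j _ hj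
    have h := (hind.indepFun hj.symm).integral_mul_eq_mul_integral
      (hX i).aestronglyMeasurable (hX j).aestronglyMeasurable
    have h' : ∫ ω, X i ω * X j ω ∂P = 0 := by
      have := h
      simp only [Pi.mul_apply, h0, mul_zero] at this
      exact this
    rw [integral_const_mul, h', mul_zero]
  · simp

end HansonWright

/-! ### Operator norms of moving averages and of the lag-window matrix -/

section L2Bound

variable {κ ι ν : Type*} [Fintype κ] [Fintype ι] [Fintype ν]

theorem HasL2Bound.transpose {B : Matrix κ ι ℝ} {b : ℝ} (hb : HasL2Bound B b) :
    HasL2Bound B.transpose b := by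
  intro y
  set z := B.transpose.mulVec y with hz
  set S := ∑ j, z j ^ 2 with hS
  have hS0 : 0 ≤ S := Finset.sum_nonneg fun _ _ => sq_nonneg _
  have h1 : S = ∑ i, y i * B.mulVec z i := by
    have : z ⬝ᵥ z = y ⬝ᵥ B.mulVec z := by
      rw [Matrix.dotProduct_mulVec, ← Matrix.mulVec_transpose,
        Matrix.transpose_transpose, dotProduct_comm]
    simpa [dotProduct, hS, sq] using this
  have h2 : S ^ 2 ≤ (∑ i, y i ^ 2) * (b ^ 2 * S) := by
    calc S ^ 2 = (∑ i, y i * B.mulVec z i) ^ 2 := by rw [← h1]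
      _ ≤ (∑ i, y i ^ 2) * ∑ i, B.mulVec z i ^ 2 := Finset.sum_mul_sq_le_sq_mul_sq _ _ _
      _ ≤ _ := mul_le_mul_of_nonneg_left (hb z) (Finset.sum_nonneg fun _ _ => sq_nonneg _)
  rcases hS0.eq_or_lt with h | h
  · rw [← h]
    exact mul_nonneg (sq_nonneg _) (Finset.sum_nonneg fun _ _ => sq_nonneg _)
  · exact le_of_mul_le_mul_right (by linarith) h

theorem HasL2Bound.mul {A : Matrix ν κ ℝ} {B : Matrix κ ι ℝ} {a b : ℝ} (ha : HasL2Bound A a)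
    (hb : HasL2Bound B b) : HasL2Bound (A * B) (a * b) := by
  intro x
  rw [← Matrix.mulVec_mulVec]
  refine (ha _).trans ?_
  rw [mul_pow, mul_assoc]
  exact mul_le_mul_of_nonneg_left (hb x) (sq_nonneg a)

/-- The Frobenius norm of `A * B` is at most the operator norm of `A` times the Frobenius norm of
`B`. -/
theorem HasL2Bound.sum_sq_mul_le {A : Matrix ν κ ℝ} {a : ℝ} (ha : HasL2Bound A a)
    (B : Matrix κ ι ℝ) : ∑ i, ∑ j, (A * B) i j ^ 2 ≤ a ^ 2 * ∑ i, ∑ j, B i j ^ 2 := by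
  rw [Finset.sum_comm, Finset.sum_comm (f := fun i j => B i j ^ 2), Finset.mul_sum]
  exact Finset.sum_le_sum fun j _ => ha fun k => B k j

theorem HasL2Bound.sum_sq_mul_le' {A : Matrix κ ι ℝ} {a : ℝ} (ha : HasL2Bound A a)
    (B : Matrix ν κ ℝ) : ∑ i, ∑ j, (B * A) i j ^ 2 ≤ a ^ 2 * ∑ i, ∑ j, B i j ^ 2 := by
  have h := ha.transpose.sum_sq_mul_le B.transpose
  rw [← Matrix.transpose_mul] at h
  simp only [Matrix.transpose_apply] at h
  rwa [Finset.sum_comm, Finset.sum_comm (f := fun i j => B j i ^ 2)] at h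

/-- The **Schur test** with equal bounds on rows and columns. -/
theorem hasL2Bound_of_sum_abs_le {W : Matrix κ ι ℝ} {b : ℝ} (hb : 0 ≤ b)
    (hrow : ∀ i, ∑ j, |W i j| ≤ b) (hcol : ∀ j, ∑ i, |W i j| ≤ b) : HasL2Bound W b := by
  intro x
  have h1 : ∀ i, W.mulVec x i ^ 2 ≤ b * ∑ j, |W i j| * x j ^ 2 := by
    intro i
    refine (Finset.sum_sq_le_sum_mul_sum_of_sq_le_mul Finset.univ
      (f := fun j => |W i j|) (g := fun j => |W i j| * x j ^ 2) (r := fun j => W i j * x j)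
      (fun _ _ => abs_nonneg _)
      (fun _ _ => mul_nonneg (abs_nonneg _) (sq_nonneg _)) fun j _ => ?_).trans ?_
    · rw [mul_pow, ← mul_assoc, ← sq, sq_abs]
    · exact mul_le_mul_of_nonneg_right (hrow i)
        (Finset.sum_nonneg fun _ _ => mul_nonneg (abs_nonneg _) (sq_nonneg _))
  refine (Finset.sum_le_sum fun i _ => h1 i).trans ?_
  rw [← Finset.mul_sum, Finset.sum_comm, sq b, mul_assoc]
  refine mul_le_mul_of_nonneg_left ?_ hb
  rw [Finset.mul_sum]
  refine Finset.sum_le_sum fun j _ => ?_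
  rw [← Finset.sum_mul]
  exact mul_le_mul_of_nonneg_right (hcol j) (sq_nonneg _)

end L2Bound

theorem hasL2Bound_matrixOpNorm {p : ℕ} (A : Matrix (Fin p) (Fin p) ℝ) :
    HasL2Bound A (matrixOpNorm A) := by
  intro x
  have h := (Matrix.toEuclideanCLM (𝕜 := ℝ) A).le_opNorm (WithLp.toLp 2 x)
  have h2 := pow_le_pow_left₀ (norm_nonneg _) h 2
  rw [mul_pow, EuclideanSpace.norm_sq_eq, EuclideanSpace.norm_sq_eq] at h2
  simpa [matrixOpNorm] using h2

theorem sum_row_sq_le_matrixOpNorm_sq {p : ℕ} (A : Matrix (Fin p) (Fin p) ℝ) (r : Fin p) :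
    ∑ q, A r q ^ 2 ≤ matrixOpNorm A ^ 2 := by
  have h := (hasL2Bound_matrixOpNorm A).transpose (Pi.single r 1)
  have e : ∑ k, (Pi.single r 1 : Fin p → ℝ) k ^ 2 = 1 := by
    simp [Pi.single_apply]
  rw [e, mul_one] at h
  simpa using h

theorem matrixOpNorm_nonneg {p : ℕ} (A : Matrix (Fin p) (Fin p) ℝ) : 0 ≤ matrixOpNorm A :=
  norm_nonneg _

section MovingAverage

variable {κ : Type*} {p : ℕ}

/-- The matrix of the finite moving average `t ↦ ∑_k v_k ⬝ x_{t - s_k}`, from the vectors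
`x_τ ∈ ℝᵖ`, `τ ∈ S`, to the real numbers indexed by `T`. -/
noncomputable def movingAverageMatrix (T S : Finset ℤ) (J : Finset κ) (s : κ → ℤ)
    (v : κ → Fin p → ℝ) : Matrix T (S × Fin p) ℝ :=
  Matrix.of fun t i => ∑ k ∈ J, if (t : ℤ) - s k = i.1 then v k i.2 else 0

theorem movingAverageMatrix_mulVec_apply (T S : Finset ℤ) (J : Finset κ) (s : κ → ℤ)
    (v : κ → Fin p → ℝ) (x : S × Fin p → ℝ) (t : T) :
    (movingAverageMatrix T S J s v).mulVec x t
      = ∑ k ∈ J, ∑ i, (if (t : ℤ) - s k = i.1 then v k i.2 else 0) * x i := by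
  simp only [movingAverageMatrix, Matrix.mulVec, dotProduct, Matrix.of_apply, Finset.sum_mul]
  rw [Finset.sum_comm]

theorem movingAverageMatrix_mulVec (T S : Finset ℤ) (J : Finset κ) (s : κ → ℤ)
    (v : κ → Fin p → ℝ) (x : ℤ → Fin p → ℝ) (t : T) (hS : ∀ k ∈ J, (t : ℤ) - s k ∈ S) :
    (movingAverageMatrix T S J s v).mulVec (fun i => x i.1 i.2) t
      = ∑ k ∈ J, ∑ q, v k q * x (t - s k) q := by
  rw [movingAverageMatrix_mulVec_apply]
  refine Finset.sum_congr rfl fun k hk => ?_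
  rw [Fintype.sum_prod_type, Finset.sum_eq_single ⟨(t : ℤ) - s k, hS k hk⟩]
  · simp
  · intro τ _ hτ
    have : ¬ (t : ℤ) - s k = τ := fun h => hτ (Subtype.ext h.symm)
    simp [this]
  · simp

theorem sum_subtype_ite_eq_le (S : Finset ℤ) (z : ℤ) {c : ℝ} (hc : 0 ≤ c) :
    ∑ τ : S, (if z = (τ : ℤ) then c else 0) ≤ c := by
  rw [Finset.sum_coe_sort S (fun τ => if z = τ then c else 0), Finset.sum_ite_eq]
  split_ifs
  · exact le_rfl
  · exact hc

/-- **Young's convolution inequality** `ℓ¹ * ℓ² ⊆ ℓ²` for moving averages with vector-valued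
coefficients; it is the Cauchy–Schwarz inequality with weights `w`. -/
theorem hasL2Bound_movingAverageMatrix (T S : Finset ℤ) (J : Finset κ) (s : κ → ℤ)
    (v : κ → Fin p → ℝ) (w : κ → ℝ) {ρ : ℝ} (hw : ∀ k ∈ J, 0 ≤ w k)
    (hv : ∀ k ∈ J, ∑ q, v k q ^ 2 ≤ w k ^ 2) (hρ : ∑ k ∈ J, w k ≤ ρ) :
    HasL2Bound (movingAverageMatrix T S J s v) ρ := by
  intro x
  have hW0 : 0 ≤ ∑ k ∈ J, w k := Finset.sum_nonneg hw
  let g : κ → T → ℝ := fun k t => ∑ i, if (t : ℤ) - s k = i.1 then x i ^ 2 else 0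
  have hg0 : ∀ k t, 0 ≤ g k t := fun k t => Finset.sum_nonneg fun i _ => by
    split_ifs <;> positivity
  have h1 : ∀ t, (movingAverageMatrix T S J s v).mulVec x t ^ 2 ≤ ρ * ∑ k ∈ J, w k * g k t := by
    intro t
    rw [movingAverageMatrix_mulVec_apply]
    refine (Finset.sum_sq_le_sum_mul_sum_of_sq_le_mul J (f := w) (g := fun k => w k * g k t) hw
      (fun k hk => mul_nonneg (hw k hk) (hg0 k t)) fun k hk => ?_).trans ?_
    · have h2 : ∑ i : S × Fin p, (if (t : ℤ) - s k = i.1 then v k i.2 ^ 2 else 0) ≤ w k ^ 2 := by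
        refine le_trans ?_ (hv k hk)
        rw [Fintype.sum_prod_type, Finset.sum_comm]
        exact Finset.sum_le_sum fun q _ =>
          sum_subtype_ite_eq_le S ((t : ℤ) - s k) (sq_nonneg (v k q))
      calc _ ≤ (∑ i : S × Fin p, (if (t : ℤ) - s k = i.1 then v k i.2 ^ 2 else 0)) * g k t := by
            refine Finset.sum_sq_le_sum_mul_sum_of_sq_le_mul _ (fun i _ => ?_) (fun i _ => ?_)
              fun i _ => ?_
            · split_ifs <;> positivity
            · split_ifs <;> positivity
            · split_ifs
              · rw [mul_pow]
              · simp
        _ ≤ w k ^ 2 * g k t := mul_le_mul_of_nonneg_right h2 (hg0 k t)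
        _ = w k * (w k * g k t) := by ring
    · exact mul_le_mul_of_nonneg_right hρ
        (Finset.sum_nonneg fun k hk => mul_nonneg (hw k hk) (hg0 k t))
  have h3 : ∀ k, ∑ t, g k t ≤ ∑ i, x i ^ 2 := by
    intro k
    rw [Finset.sum_comm]
    refine Finset.sum_le_sum fun i _ => ?_
    have : ∀ t : T, ((t : ℤ) - s k = i.1) = ((i.1 : ℤ) + s k = t) := fun t => by
      apply propext; constructor <;> intro h <;> linarith
    simp_rw [this]
    exact sum_subtype_ite_eq_le T _ (sq_nonneg _)
  have hx0 : 0 ≤ ∑ i, x i ^ 2 := Finset.sum_nonneg fun _ _ => sq_nonneg _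
  calc ∑ t, (movingAverageMatrix T S J s v).mulVec x t ^ 2
      ≤ ∑ t, ρ * ∑ k ∈ J, w k * g k t := Finset.sum_le_sum fun t _ => h1 t
    _ = ρ * ∑ k ∈ J, w k * ∑ t, g k t := by
        rw [← Finset.mul_sum, Finset.sum_comm]
        simp_rw [Finset.mul_sum]
    _ ≤ ρ * ∑ k ∈ J, w k * ∑ i, x i ^ 2 := by
        refine mul_le_mul_of_nonneg_left (Finset.sum_le_sum fun k hk => ?_) (hW0.trans hρ)
        exact mul_le_mul_of_nonneg_left (h3 k) (hw k hk)
    _ ≤ ρ ^ 2 * ∑ i, x i ^ 2 := by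
        rw [← Finset.sum_mul, sq, mul_assoc]
        exact mul_le_mul_of_nonneg_left (mul_le_mul_of_nonneg_right hρ hx0) (hW0.trans hρ)

end MovingAverage

section LagWindow

/-- The matrix `W` of the lag-window estimator as a bilinear form in two observed series:
`∑_{t,t'} W_{t,t'} x_t y_{t'}` is the weighted sum over the lags `|k| < ℓ` of the empirical
cross-covariances. Only the times `t ≥ M + |k| + 1` enter, as the difference process needs `M`
earlier observations. -/
noncomputable def lagWindowMatrix (K : ℝ → ℝ) (n M ℓ : ℕ) :
    Matrix (Finset.Icc (1 : ℤ) n) (Finset.Icc (1 : ℤ) n) ℝ :=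
  Matrix.of fun t t' => ∑ k ∈ Finset.Ioo (-(ℓ : ℤ)) (ℓ : ℤ),
    if (t : ℤ) - |k| = t' then
      (if (M : ℤ) + |k| + 1 ≤ t then K ((k : ℝ) / (ℓ : ℝ)) * (n : ℝ)⁻¹ else 0) else 0

variable {K : ℝ → ℝ} {K₀ : ℝ} {n M ℓ : ℕ}

theorem abs_kernel_div_le (hK : ∀ x : ℝ, |x| ≤ 1 → |K x| ≤ K₀) {k : ℤ}
    (hk : k ∈ Finset.Ioo (-(ℓ : ℤ)) (ℓ : ℤ)) : |K ((k : ℝ) / (ℓ : ℝ))| ≤ K₀ := by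
  refine hK _ ?_
  rw [Finset.mem_Ioo, ← abs_lt] at hk
  have h : |(k : ℝ)| < ℓ := by exact_mod_cast hk
  rw [abs_div, Nat.abs_cast]
  exact div_le_one_of_le₀ h.le (Nat.cast_nonneg _)

theorem abs_lagWindowMatrix_le_sum (hK : ∀ x : ℝ, |x| ≤ 1 → |K x| ≤ K₀)
    (t t' : Finset.Icc (1 : ℤ) n) :
    |lagWindowMatrix K n M ℓ t t'| ≤ ∑ k ∈ Finset.Ioo (-(ℓ : ℤ)) (ℓ : ℤ),
      if (t : ℤ) - |k| = t' then K₀ * (n : ℝ)⁻¹ else 0 := by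
  have hK0 : 0 ≤ K₀ := (abs_nonneg _).trans (hK 0 (by simp))
  simp only [lagWindowMatrix, Matrix.of_apply]
  refine (Finset.abs_sum_le_sum_abs _ _).trans (Finset.sum_le_sum fun k hk => ?_)
  split_ifs
  · rw [abs_mul, abs_of_nonneg (show (0 : ℝ) ≤ (n : ℝ)⁻¹ by positivity)]
    exact mul_le_mul_of_nonneg_right (abs_kernel_div_le hK hk) (by positivity)
  · rw [abs_zero]; positivity
  · simp

theorem card_Ioo_neg_le (ℓ : ℕ) : ((Finset.Ioo (-(ℓ : ℤ)) (ℓ : ℤ)).card : ℝ) ≤ 2 * ℓ := by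
  have : (Finset.Ioo (-(ℓ : ℤ)) (ℓ : ℤ)).card ≤ 2 * ℓ := by
    rw [Int.card_Ioo]; omega
  exact_mod_cast this

theorem sum_abs_lagWindowMatrix_row_le (hK : ∀ x : ℝ, |x| ≤ 1 → |K x| ≤ K₀)
    (t : Finset.Icc (1 : ℤ) n) :
    ∑ t', |lagWindowMatrix K n M ℓ t t'| ≤ 2 * ℓ * (K₀ * (n : ℝ)⁻¹) := by
  have hK0 : 0 ≤ K₀ := (abs_nonneg _).trans (hK 0 (by simp))
  have hc : 0 ≤ K₀ * (n : ℝ)⁻¹ := by positivity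
  refine (Finset.sum_le_sum fun t' _ => abs_lagWindowMatrix_le_sum hK t t').trans ?_
  rw [Finset.sum_comm]
  refine (Finset.sum_le_sum fun k _ => sum_subtype_ite_eq_le _ ((t : ℤ) - |k|) hc).trans ?_
  rw [Finset.sum_const, nsmul_eq_mul]
  exact mul_le_mul_of_nonneg_right (card_Ioo_neg_le ℓ) hc

theorem sum_abs_lagWindowMatrix_col_le (hK : ∀ x : ℝ, |x| ≤ 1 → |K x| ≤ K₀)
    (t' : Finset.Icc (1 : ℤ) n) :
    ∑ t, |lagWindowMatrix K n M ℓ t t'| ≤ 2 * ℓ * (K₀ * (n : ℝ)⁻¹) := by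
  have hK0 : 0 ≤ K₀ := (abs_nonneg _).trans (hK 0 (by simp))
  have hc : 0 ≤ K₀ * (n : ℝ)⁻¹ := by positivity
  refine (Finset.sum_le_sum fun t _ => abs_lagWindowMatrix_le_sum hK t t').trans ?_
  rw [Finset.sum_comm]
  have : ∀ (k : ℤ) (t : Finset.Icc (1 : ℤ) n), ((t : ℤ) - |k| = t') = ((t' : ℤ) + |k| = t) :=
    fun k t => by apply propext; constructor <;> intro h <;> linarith
  simp_rw [this]
  refine (Finset.sum_le_sum fun k _ => sum_subtype_ite_eq_le _ ((t' : ℤ) + |k|) hc).trans ?_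
  rw [Finset.sum_const, nsmul_eq_mul]
  exact mul_le_mul_of_nonneg_right (card_Ioo_neg_le ℓ) hc

theorem abs_lagWindowMatrix_le (hK : ∀ x : ℝ, |x| ≤ 1 → |K x| ≤ K₀)
    (t t' : Finset.Icc (1 : ℤ) n) :
    |lagWindowMatrix K n M ℓ t t'| ≤ 2 * (K₀ * (n : ℝ)⁻¹) := by
  have hK0 : 0 ≤ K₀ := (abs_nonneg _).trans (hK 0 (by simp))
  have hc : 0 ≤ K₀ * (n : ℝ)⁻¹ := by positivity
  refine (abs_lagWindowMatrix_le_sum hK t t').trans ?_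
  rw [← Finset.sum_filter, Finset.sum_const, nsmul_eq_mul]
  refine mul_le_mul_of_nonneg_right ?_ hc
  -- only the lags `± (t - t')` contribute
  have hsub : (Finset.Ioo (-(ℓ : ℤ)) (ℓ : ℤ)).filter (fun k => (t : ℤ) - |k| = t')
      ⊆ {(t : ℤ) - t', (t' : ℤ) - t} := by
    intro k hk
    have h := (Finset.mem_filter.1 hk).2
    rw [Finset.mem_insert, Finset.mem_singleton]
    rcases abs_choice k with h' | h' <;> rw [h'] at h
    · left; linarith
    · right; linarith
  exact_mod_cast (Finset.card_le_card hsub).trans Finset.card_le_two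

theorem hasL2Bound_lagWindowMatrix (hK : ∀ x : ℝ, |x| ≤ 1 → |K x| ≤ K₀) :
    HasL2Bound (lagWindowMatrix K n M ℓ) (2 * ℓ * (K₀ * (n : ℝ)⁻¹)) := by
  have hK0 : 0 ≤ K₀ := (abs_nonneg _).trans (hK 0 (by simp))
  exact hasL2Bound_of_sum_abs_le (by positivity) (sum_abs_lagWindowMatrix_row_le hK)
    (sum_abs_lagWindowMatrix_col_le hK)

theorem sum_sq_lagWindowMatrix_le (hn : 0 < n) (hK : ∀ x : ℝ, |x| ≤ 1 → |K x| ≤ K₀) :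
    ∑ t, ∑ t', lagWindowMatrix K n M ℓ t t' ^ 2 ≤ 4 * K₀ ^ 2 * (ℓ / n) := by
  have hK0 : 0 ≤ K₀ := (abs_nonneg _).trans (hK 0 (by simp))
  have hc : 0 ≤ K₀ * (n : ℝ)⁻¹ := by positivity
  have hn' : (n : ℝ) ≠ 0 := by positivity
  calc ∑ t, ∑ t', lagWindowMatrix K n M ℓ t t' ^ 2
      ≤ ∑ t, ∑ t', 2 * (K₀ * (n : ℝ)⁻¹) * |lagWindowMatrix K n M ℓ t t'| := by
        refine Finset.sum_le_sum fun t _ => Finset.sum_le_sum fun t' _ => ?_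
        rw [← sq_abs, sq]
        exact mul_le_mul_of_nonneg_right (abs_lagWindowMatrix_le hK t t') (abs_nonneg _)
    _ ≤ ∑ _t : Finset.Icc (1 : ℤ) n, 2 * (K₀ * (n : ℝ)⁻¹) * (2 * ℓ * (K₀ * (n : ℝ)⁻¹)) := by
        refine Finset.sum_le_sum fun t _ => ?_
        rw [← Finset.mul_sum]
        exact mul_le_mul_of_nonneg_left (sum_abs_lagWindowMatrix_row_le hK t) (by positivity)
    _ = 4 * K₀ ^ 2 * (ℓ / n) := by
        rw [Finset.sum_const, nsmul_eq_mul, Finset.card_univ, Fintype.card_coe, Int.card_Icc]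
        simp only [add_sub_cancel_right, Int.toNat_natCast]
        field_simp
        ring

/-- The defining property of the lag-window matrix. -/
theorem sum_lagWindowMatrix_mul (x y : ℤ → ℝ) :
    ∑ t, ∑ t', lagWindowMatrix K n M ℓ t t' * (x t * y t')
      = ∑ k ∈ Finset.Ioo (-(ℓ : ℤ)) (ℓ : ℤ), K ((k : ℝ) / (ℓ : ℝ)) * ((n : ℝ)⁻¹ *
          ∑ t ∈ Finset.Icc ((M : ℤ) + |k| + 1) (n : ℤ), x t * y (t - |k|)) := by
  simp only [lagWindowMatrix, Matrix.of_apply, Finset.sum_mul]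
  have e1 : ∀ t : Finset.Icc (1 : ℤ) n, ∀ k : ℤ,
      ∑ t' : Finset.Icc (1 : ℤ) n, (if (t : ℤ) - |k| = t' then
        (if (M : ℤ) + |k| + 1 ≤ t then K ((k : ℝ) / (ℓ : ℝ)) * (n : ℝ)⁻¹ else 0) else 0)
          * (x t * y t')
      = if (M : ℤ) + |k| + 1 ≤ t then K ((k : ℝ) / (ℓ : ℝ)) * (n : ℝ)⁻¹ * (x t * y (t - |k|))
        else 0 := by
    intro t k
    by_cases h : (M : ℤ) + |k| + 1 ≤ t
    · have ht := Finset.mem_Icc.1 t.2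
      have hmem : (t : ℤ) - |k| ∈ Finset.Icc (1 : ℤ) n :=
        Finset.mem_Icc.2 ⟨by linarith [Int.natCast_nonneg M], by linarith [abs_nonneg k]⟩
      rw [Finset.sum_eq_single ⟨(t : ℤ) - |k|, hmem⟩]
      · simp [h]
      · intro t' _ ht'
        have : ¬ (t : ℤ) - |k| = t' := fun e => ht' (Subtype.ext e.symm)
        simp [this]
      · simp
    · simp [h]
  have e2 : ∀ t : Finset.Icc (1 : ℤ) n,
      ∑ t' : Finset.Icc (1 : ℤ) n, ∑ k ∈ Finset.Ioo (-(ℓ : ℤ)) (ℓ : ℤ), (if (t : ℤ) - |k| = t' then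
        (if (M : ℤ) + |k| + 1 ≤ t then K ((k : ℝ) / (ℓ : ℝ)) * (n : ℝ)⁻¹ else 0) else 0)
          * (x t * y t')
      = ∑ k ∈ Finset.Ioo (-(ℓ : ℤ)) (ℓ : ℤ), if (M : ℤ) + |k| + 1 ≤ t then
        K ((k : ℝ) / (ℓ : ℝ)) * (n : ℝ)⁻¹ * (x t * y (t - |k|)) else 0 := by
    intro t
    rw [Finset.sum_comm]
    exact Finset.sum_congr rfl fun k _ => e1 t k
  simp_rw [e2]
  rw [Finset.sum_comm]
  refine Finset.sum_congr rfl fun k _ => ?_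
  rw [Finset.sum_coe_sort (Finset.Icc (1 : ℤ) n) (fun t => if (M : ℤ) + |k| + 1 ≤ t then
        K ((k : ℝ) / (ℓ : ℝ)) * (n : ℝ)⁻¹ * (x t * y (t - |k|)) else 0), ← Finset.sum_filter,
    ← mul_assoc, Finset.mul_sum]
  refine Finset.sum_congr ?_ fun _ _ => rfl
  ext t
  simp only [Finset.mem_filter, Finset.mem_Icc]
  constructor
  · rintro ⟨⟨_, h2⟩, h3⟩
    exact ⟨h3, h2⟩
  · rintro ⟨h3, h2⟩
    exact ⟨⟨by linarith [Int.natCast_nonneg M, abs_nonneg k], h2⟩, h3⟩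

end LagWindow

/-! ### The oracle estimator of a truncated linear process as a quadratic form -/

theorem lintegral_exp_sq_le_two_of_psiTwoNorm_lt {Ω : Type*} [MeasurableSpace Ω] {P : Measure Ω}
    {X : Ω → ℝ} {σ : ℝ} (h : psiTwoNorm P X < ENNReal.ofReal σ) :
    ∫⁻ ω, ENNReal.ofReal (Real.exp (X ω ^ 2 / σ ^ 2)) ∂P ≤ 2 := by
  simp only [psiTwoNorm, iInf_lt_iff] at h
  obtain ⟨s, hs, h2, hlt⟩ := h
  have hsσ : s ≤ σ := (ENNReal.ofReal_lt_ofReal_iff_of_nonneg hs.le).1 hlt |>.le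
  refine le_trans (lintegral_mono fun ω => ENNReal.ofReal_le_ofReal (Real.exp_le_exp.2 ?_)) h2
  gcongr

theorem dotProduct_mulVec_eq_sum {κ : Type*} [Fintype κ] (N : Matrix κ κ ℝ) (v w : κ → ℝ) :
    v ⬝ᵥ N.mulVec w = ∑ i, ∑ j, N i j * (v i * w j) := by
  simp only [Matrix.mulVec, dotProduct, Finset.mul_sum]
  exact Finset.sum_congr rfl fun i _ => Finset.sum_congr rfl fun j _ => by ring

theorem sum_mul_mulVec_mul_mulVec {T ι : Type*} [Fintype T] [Fintype ι] (W : Matrix T T ℝ)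
    (R R' : Matrix T ι ℝ) (x : ι → ℝ) :
    ∑ t, ∑ t', W t t' * (R.mulVec x t * R'.mulVec x t')
      = ∑ i, ∑ j, (R.transpose * (W * R')) i j * (x i * x j) := by
  rw [← dotProduct_mulVec_eq_sum, ← dotProduct_mulVec_eq_sum, ← Matrix.mulVec_mulVec,
    ← Matrix.mulVec_mulVec, Matrix.dotProduct_mulVec x, ← Matrix.mulVec_transpose,
    Matrix.transpose_transpose]

section Oracle

variable {Ω : Type*} {p : ℕ}

theorem noiseDiff_apply (m h : ℕ) (d : ℕ → ℝ) (Z : ℤ → Ω → Fin p → ℝ) (t : ℤ) (ω : Ω)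
    (r : Fin p) : noiseDiff m h d Z t ω r
      = ∑ j ∈ Finset.range (m + 1), d j * Z (t - (j : ℤ) * (h : ℤ)) ω r := by
  simp [noiseDiff, Finset.sum_apply]

theorem oracleLRV_apply (K : ℝ → ℝ) (n m h ℓ : ℕ) (d : ℕ → ℝ) (Z : ℤ → Ω → Fin p → ℝ) (ω : Ω)
    (r s : Fin p) : oracleLRV K n m h ℓ d Z ω r s
      = ∑ k ∈ Finset.Ioo (-(ℓ : ℤ)) (ℓ : ℤ), K ((k : ℝ) / (ℓ : ℝ)) * ((n : ℝ)⁻¹ *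
          ∑ t ∈ Finset.Icc ((m : ℤ) * (h : ℤ) + |k| + 1) (n : ℤ),
            noiseDiff m h d Z t ω r * noiseDiff m h d Z (t - |k|) ω s) := by
  simp [oracleLRV, oracleAutocov, Matrix.sum_apply, Matrix.smul_apply, Matrix.vecMulVec_apply]

/-- The linear process with the filter truncated to its first `N` coefficients. -/
noncomputable def truncatedProcess (A : ℕ → Matrix (Fin p) (Fin p) ℝ) (ε : ℤ → Ω → Fin p → ℝ)
    (N : ℕ) (t : ℤ) (ω : Ω) : Fin p → ℝ :=
  ∑ a ∈ Finset.range N, (A a).mulVec (ε (t - (a : ℤ)) ω)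

/-- The map from the innovations to the `r`-th coordinate of the difference process of the
truncated linear process. -/
noncomputable def noiseDiffMatrix (n m h : ℕ) (d : ℕ → ℝ) (A : ℕ → Matrix (Fin p) (Fin p) ℝ)
    (N : ℕ) (r : Fin p) :
    Matrix (Finset.Icc (1 : ℤ) n) (Finset.Icc (1 - (m * h : ℕ) - N : ℤ) n × Fin p) ℝ :=
  movingAverageMatrix _ _ (Finset.range (m + 1) ×ˢ Finset.range N)
    (fun k => (k.1 : ℤ) * (h : ℤ) + (k.2 : ℤ)) (fun k q => d k.1 * A k.2 r q)

theorem noiseDiffMatrix_mulVec (n m h : ℕ) (d : ℕ → ℝ) (A : ℕ → Matrix (Fin p) (Fin p) ℝ)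
    (N : ℕ) (r : Fin p) (ε : ℤ → Ω → Fin p → ℝ) (ω : Ω) (t : Finset.Icc (1 : ℤ) n) :
    (noiseDiffMatrix n m h d A N r).mulVec (fun i => ε i.1 ω i.2) t
      = noiseDiff m h d (truncatedProcess A ε N) t ω r := by
  rw [noiseDiffMatrix, movingAverageMatrix_mulVec _ _ _ _ _ (fun τ q => ε τ ω q),
    noiseDiff_apply, Finset.sum_product]
  · refine Finset.sum_congr rfl fun j _ => ?_
    simp only [truncatedProcess, Finset.sum_apply, Matrix.mulVec, dotProduct, Finset.mul_sum]
    refine Finset.sum_congr rfl fun a _ => Finset.sum_congr rfl fun q _ => ?_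
    rw [sub_sub, mul_assoc]
  · rintro ⟨j, a⟩ hk
    obtain ⟨hj, ha⟩ := Finset.mem_product.1 hk
    have ht := Finset.mem_Icc.1 t.2
    have hjm : j * h ≤ m * h := Nat.mul_le_mul_right h (Nat.lt_succ_iff.1 (Finset.mem_range.1 hj))
    have hjm' : (j : ℤ) * (h : ℤ) ≤ ((m * h : ℕ) : ℤ) := by exact_mod_cast hjm
    have ha' : (a : ℤ) < N := by exact_mod_cast Finset.mem_range.1 ha
    have h0 : 0 ≤ (j : ℤ) * (h : ℤ) := by positivity
    exact Finset.mem_Icc.2 ⟨by simp only; linarith, by simp only; linarith [Int.natCast_nonneg a]⟩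

theorem hasL2Bound_noiseDiffMatrix {n m h : ℕ} {d : ℕ → ℝ} {A : ℕ → Matrix (Fin p) (Fin p) ℝ}
    {KA KA' β Kd : ℝ} (hA : IsStableFilter A KA KA' β)
    (hd : ∑ j ∈ Finset.range (m + 1), |d j| ≤ Kd) (N : ℕ) (r : Fin p) :
    HasL2Bound (noiseDiffMatrix n m h d A N r) (Kd * KA) := by
  refine hasL2Bound_movingAverageMatrix _ _ _ _ _ (fun k => |d k.1| * matrixOpNorm (A k.2))
    (fun k _ => mul_nonneg (abs_nonneg _) (matrixOpNorm_nonneg _)) (fun k _ => ?_) ?_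
  · simp_rw [mul_pow, sq_abs, ← Finset.mul_sum]
    exact mul_le_mul_of_nonneg_left (sum_row_sq_le_matrixOpNorm_sq _ _) (sq_nonneg _)
  · rw [Finset.sum_product]
    simp only
    rw [← Finset.sum_mul_sum]
    have h1 : ∑ a ∈ Finset.range N, matrixOpNorm (A a) ≤ KA :=
      (hA.summable.sum_le_tsum _ fun _ _ => matrixOpNorm_nonneg _).trans hA.tsum_le
    exact mul_le_mul hd h1 (Finset.sum_nonneg fun _ _ => matrixOpNorm_nonneg _)
      ((Finset.sum_nonneg fun _ _ => abs_nonneg _).trans hd)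

/-- The quadratic form `xᵀ (Rᵀ W R') x` in the innovations `x`. -/
theorem oracleLRV_truncatedProcess_apply (K : ℝ → ℝ) (n m h ℓ : ℕ) (d : ℕ → ℝ)
    (A : ℕ → Matrix (Fin p) (Fin p) ℝ) (ε : ℤ → Ω → Fin p → ℝ) (N : ℕ) (ω : Ω) (r s : Fin p) :
    oracleLRV K n m h ℓ d (truncatedProcess A ε N) ω r s
      = ∑ i, ∑ j, ((noiseDiffMatrix n m h d A N r).transpose * (lagWindowMatrix K n (m * h) ℓ
          * noiseDiffMatrix n m h d A N s)) i j * (ε i.1 ω i.2 * ε j.1 ω j.2) := by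
  rw [← sum_mul_mulVec_mul_mulVec _ _ _ (fun i : Finset.Icc (1 - (m * h : ℕ) - N : ℤ) n × Fin p =>
    ε i.1 ω i.2)]
  simp_rw [noiseDiffMatrix_mulVec]
  rw [oracleLRV_apply, sum_lagWindowMatrix_mul
    (fun t => noiseDiff m h d (truncatedProcess A ε N) t ω r)
    (fun t => noiseDiff m h d (truncatedProcess A ε N) t ω s)]
  push_cast
  rfl

variable [MeasurableSpace Ω] {P : Measure Ω}
  {ε : ℤ → Ω → Fin p → ℝ} {A : ℕ → Matrix (Fin p) (Fin p) ℝ} {Kε KA KA' β Kd K₀ σ : ℝ}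

theorem IsSubGaussianInnovation.lintegral_exp_sq_le (hε : IsSubGaussianInnovation P ε Kε)
    (hσ : 0 < σ) (hKσ : Kε < σ) (τ : ℤ) (q : Fin p) :
    ∫⁻ ω, ENNReal.ofReal (Real.exp (ε τ ω q ^ 2 / σ ^ 2)) ∂P ≤ 2 := by
  have h0 : ∫⁻ ω, ENNReal.ofReal (Real.exp (ε 0 ω q ^ 2 / σ ^ 2)) ∂P ≤ 2 :=
    lintegral_exp_sq_le_two_of_psiTwoNorm_lt
      ((hε.psiTwo_le q).trans_lt ((ENNReal.ofReal_lt_ofReal_iff hσ).2 hKσ))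
  have h := (hε.identDistrib τ).comp (u := fun x : Fin p → ℝ =>
    ENNReal.ofReal (Real.exp (x q ^ 2 / σ ^ 2))) (by fun_prop)
  exact (le_of_eq h.lintegral_eq).trans h0

theorem IsSubGaussianInnovation.iIndepFun_coord (hε : IsSubGaussianInnovation P ε Kε)
    (S : Finset ℤ) : iIndepFun (fun (i : S × Fin p) ω => ε i.1 ω i.2) P := by
  have hm : ∀ (τ : ℤ) (q : Fin p), Measurable fun ω => ε τ ω q := fun τ q =>
    (measurable_pi_apply q).comp (hε.measurable τ)
  have h := iIndepFun_uncurry' (X := fun (τ : ℤ) (q : Fin p) ω => ε τ ω q) hm hε.indep_time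
    hε.indep_coord
  exact h.precomp (g := fun i : S × Fin p => ((i.1 : ℤ), i.2)) fun i j hij =>
    Prod.ext (Subtype.ext (Prod.mk.inj hij).1) (Prod.mk.inj hij).2

/-- The bound on the moment generating function for the truncated process, uniform in the
truncation level `N`. It is the Hanson–Wright inequality for `M = Rᵀ W R'`, with operator norm
`O(ℓ / n)` and squared Frobenius norm `O(ℓ / n)`. -/
theorem lintegral_exp_oracleLRV_truncatedProcess_le [IsProbabilityMeasure P]
    (hε : IsSubGaussianInnovation P ε Kε)
    (hσ : 0 < σ) (hKσ : Kε < σ) (hA : IsStableFilter A KA KA' β) {K : ℝ → ℝ}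
    (hK : ∀ x : ℝ, |x| ≤ 1 → |K x| ≤ K₀) {n m h ℓ : ℕ} (hn : 0 < n) {d : ℕ → ℝ}
    (hd : ∑ j ∈ Finset.range (m + 1), |d j| ≤ Kd) (r s : Fin p) {u : ℝ}
    (hu : 80 * (σ ^ 2 * (Kd * KA) ^ 2 * K₀) * (|u| * (ℓ / n)) ≤ 1) (N : ℕ) :
    ∫⁻ ω, ENNReal.ofReal (Real.exp (u * (oracleLRV K n m h ℓ d (truncatedProcess A ε N) ω r s
        - ∫ ω', oracleLRV K n m h ℓ d (truncatedProcess A ε N) ω' r s ∂P))) ∂P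
      ≤ ENNReal.ofReal (Real.exp (2400 * (σ ^ 2 * (Kd * KA) ^ 2 * K₀) ^ 2 * u ^ 2 * (ℓ / n))) := by
  have hK0 : 0 ≤ K₀ := (abs_nonneg _).trans (hK 0 (by simp))
  have hR := hasL2Bound_noiseDiffMatrix (n := n) (h := h) hA hd N
  have hW := hasL2Bound_lagWindowMatrix (n := n) (M := m * h) (ℓ := ℓ) hK
  set M := (noiseDiffMatrix n m h d A N r).transpose * (lagWindowMatrix K n (m * h) ℓ
          * noiseDiffMatrix n m h d A N s) with hM
  have hMb : HasL2Bound M (2 * (Kd * KA) ^ 2 * K₀ * (ℓ / n)) := by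
    have := (hR r).transpose.mul (hW.mul (hR s))
    convert this using 1
    ring
  have hMF : ∑ i, ∑ j, M i j ^ 2 ≤ 4 * ((Kd * KA) ^ 2 * K₀) ^ 2 * (ℓ / n) := by
    refine ((hR r).transpose.sum_sq_mul_le _).trans ?_
    calc _ ≤ (Kd * KA) ^ 2 * ((Kd * KA) ^ 2 * (4 * K₀ ^ 2 * (ℓ / n))) := by
          refine mul_le_mul_of_nonneg_left (((hR s).sum_sq_mul_le' _).trans ?_) (sq_nonneg _)
          exact mul_le_mul_of_nonneg_left (sum_sq_lagWindowMatrix_le hn hK) (sq_nonneg _)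
      _ = _ := by ring
  have hX : ∀ i : Finset.Icc (1 - (m * h : ℕ) - N : ℤ) n × Fin p,
      Measurable fun ω => ε i.1 ω i.2 := fun i =>
    (measurable_pi_apply i.2).comp (hε.measurable i.1)
  have hψ : ∀ i : Finset.Icc (1 - (m * h : ℕ) - N : ℤ) n × Fin p,
      ∫⁻ ω, ENNReal.ofReal (Real.exp (ε i.1 ω i.2 ^ 2 / σ ^ 2)) ∂P ≤ 2 := fun i =>
    hε.lintegral_exp_sq_le hσ hKσ i.1 i.2
  have hind := hε.iIndepFun_coord (Finset.Icc (1 - (m * h : ℕ) - N : ℤ) n)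
  have h0 : ∀ i : Finset.Icc (1 - (m * h : ℕ) - N : ℤ) n × Fin p, ∫ ω, ε i.1 ω i.2 ∂P = 0 :=
    fun i => hε.centered i.1 i.2
  have hu' : 40 * (σ ^ 2 * |u| * (2 * (Kd * KA) ^ 2 * K₀ * (ℓ / n))) ≤ 1 := by
    refine le_of_eq_of_le ?_ hu
    ring
  have hHW := lintegral_exp_quadratic_le hσ hX hind h0 hψ M (by positivity) hMb hu'
  rw [← integral_quadratic hσ hX hind h0 hψ M] at hHW
  simp_rw [oracleLRV_truncatedProcess_apply]
  refine hHW.trans (ENNReal.ofReal_le_ofReal (Real.exp_le_exp.2 ?_))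
  calc 600 * σ ^ 4 * u ^ 2 * ∑ i, ∑ j, M i j ^ 2
      ≤ 600 * σ ^ 4 * u ^ 2 * (4 * ((Kd * KA) ^ 2 * K₀) ^ 2 * (ℓ / n)) :=
        mul_le_mul_of_nonneg_left hMF (by positivity)
    _ = _ := by ring

end Oracle

/-! ### Removing the truncation and the Chernoff bound -/

/-- `v N → w` almost surely, with an integrable bound on all `|v N|`: the hypotheses of the
dominated convergence theorem. -/
structure IsDominatedLimit {Ω : Type*} [MeasurableSpace Ω] (P : Measure Ω) (v : ℕ → Ω → ℝ)
    (w : Ω → ℝ) : Prop where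
  aesm : ∀ N, AEStronglyMeasurable (v N) P
  bound : ∃ G : Ω → ℝ, Integrable G P ∧ ∀ N, ∀ᵐ ω ∂P, |v N ω| ≤ G ω
  tendsto : ∀ᵐ ω ∂P, Tendsto (fun N => v N ω) atTop (𝓝 (w ω))

namespace IsDominatedLimit

variable {Ω : Type*} [MeasurableSpace Ω] {P : Measure Ω} {v : ℕ → Ω → ℝ} {w : Ω → ℝ}

theorem const_mul (h : IsDominatedLimit P v w) (c : ℝ) :
    IsDominatedLimit P (fun N ω => c * v N ω) (fun ω => c * w ω) := by
  obtain ⟨G, hG, hb⟩ := h.bound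
  refine ⟨fun N => (h.aesm N).const_mul c, ⟨fun ω => |c| * G ω, hG.const_mul _, fun N => ?_⟩, ?_⟩
  · filter_upwards [hb N] with ω hω
    rw [abs_mul]
    exact mul_le_mul_of_nonneg_left hω (abs_nonneg c)
  · filter_upwards [h.tendsto] with ω hω using hω.const_mul c

theorem sum {κ : Type*} (J : Finset κ) {v : κ → ℕ → Ω → ℝ} {w : κ → Ω → ℝ}
    (h : ∀ k, IsDominatedLimit P (v k) (w k)) :
    IsDominatedLimit P (fun N ω => ∑ k ∈ J, v k N ω) (fun ω => ∑ k ∈ J, w k ω) := by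
  choose G hG hb using fun k => (h k).bound
  refine ⟨fun N => Finset.aestronglyMeasurable_fun_sum J fun k _ => (h k).aesm N,
    ⟨fun ω => ∑ k ∈ J, G k ω, integrable_finsetSum _ fun k _ => hG k, fun N => ?_⟩, ?_⟩
  · have : ∀ᵐ ω ∂P, ∀ k ∈ J, |v k N ω| ≤ G k ω :=
      (ae_ball_iff J.countable_toSet).2 fun k _ => hb k N
    filter_upwards [this] with ω hω
    exact (Finset.abs_sum_le_sum_abs _ _).trans (Finset.sum_le_sum hω)
  · have : ∀ᵐ ω ∂P, ∀ k ∈ J, Tendsto (fun N => v k N ω) atTop (𝓝 (w k ω)) :=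
      (ae_ball_iff J.countable_toSet).2 fun k _ => (h k).tendsto
    filter_upwards [this] with ω hω
    exact tendsto_finsetSum _ hω

theorem integrable (h : IsDominatedLimit P v w) : Integrable w P := by
  obtain ⟨G, hG, hb⟩ := h.bound
  refine hG.mono' (aestronglyMeasurable_of_tendsto_ae atTop h.aesm h.tendsto) ?_
  filter_upwards [ae_all_iff.2 hb, h.tendsto] with ω h1 h2
  exact le_of_tendsto h2.abs (Eventually.of_forall h1)

theorem tendsto_integral (h : IsDominatedLimit P v w) :
    Tendsto (fun N => ∫ ω, v N ω ∂P) atTop (𝓝 (∫ ω, w ω ∂P)) := by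
  obtain ⟨G, hG, hb⟩ := h.bound
  exact tendsto_integral_of_dominated_convergence G h.aesm hG hb h.tendsto

/-- A uniform bound on centred exponential moments passes to the limit, by Fatou's lemma. -/
theorem lintegral_exp_le (h : IsDominatedLimit P v w) {u : ℝ} {B : ℝ≥0∞}
    (hB : ∀ N, ∫⁻ ω, ENNReal.ofReal (Real.exp (u * (v N ω - ∫ ω', v N ω' ∂P))) ∂P ≤ B) :
    ∫⁻ ω, ENNReal.ofReal (Real.exp (u * (w ω - ∫ ω', w ω' ∂P))) ∂P ≤ B := by
  have hlim : ∀ᵐ ω ∂P, ENNReal.ofReal (Real.exp (u * (w ω - ∫ ω', w ω' ∂P)))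
      = liminf (fun N => ENNReal.ofReal (Real.exp (u * (v N ω - ∫ ω', v N ω' ∂P)))) atTop := by
    filter_upwards [h.tendsto] with ω hω
    refine (Tendsto.liminf_eq ?_).symm
    exact (ENNReal.continuous_ofReal.tendsto _).comp
      ((Real.continuous_exp.tendsto _).comp ((hω.sub h.tendsto_integral).const_mul u))
  rw [lintegral_congr_ae hlim]
  refine (lintegral_liminf_le' fun N => ?_).trans ?_
  · exact (Real.measurable_exp.comp_aemeasurable
      (((h.aesm N).aemeasurable.sub_const _).const_mul u)).ennreal_ofReal
  · exact liminf_le_of_frequently_le' (Frequently.of_forall hB)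

end IsDominatedLimit

section Limit

variable {Ω : Type*} {p : ℕ} [MeasurableSpace Ω] {P : Measure Ω}
  {ε Z : ℤ → Ω → Fin p → ℝ} {A : ℕ → Matrix (Fin p) (Fin p) ℝ} {Kε KA KA' β Kd K₀ σ : ℝ}

theorem truncatedProcess_sq_le {Ω : Type*} {ε : ℤ → Ω → Fin p → ℝ}
    (hA : IsStableFilter A KA KA' β) (N : ℕ) (t : ℤ) (ω : Ω) (r : Fin p) :
    truncatedProcess A ε N t ω r ^ 2
      ≤ KA * ∑ a ∈ Finset.range N, matrixOpNorm (A a) * ∑ q, ε (t - a) ω q ^ 2 := by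
  have hn : ∀ a ∈ Finset.range N, 0 ≤ matrixOpNorm (A a) * ∑ q, ε (t - a) ω q ^ 2 := fun a _ =>
    mul_nonneg (matrixOpNorm_nonneg _) (Finset.sum_nonneg fun _ _ => sq_nonneg _)
  have h1 : ∑ a ∈ Finset.range N, matrixOpNorm (A a) ≤ KA :=
    (hA.summable.sum_le_tsum _ fun _ _ => matrixOpNorm_nonneg _).trans hA.tsum_le
  simp only [truncatedProcess, Finset.sum_apply]
  refine (Finset.sum_sq_le_sum_mul_sum_of_sq_le_mul _ (f := fun a => matrixOpNorm (A a))
    (g := fun a => matrixOpNorm (A a) * ∑ q, ε (t - a) ω q ^ 2)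
    (fun a _ => matrixOpNorm_nonneg _) hn fun a _ => ?_).trans
      (mul_le_mul_of_nonneg_right h1 (Finset.sum_nonneg hn))
  rw [← mul_assoc, ← sq]
  exact (Finset.single_le_sum (f := fun r => (A a).mulVec (ε (t - a) ω) r ^ 2)
    (fun _ _ => sq_nonneg _) (Finset.mem_univ r)).trans (hasL2Bound_matrixOpNorm (A a) _)

theorem measurable_truncatedProcess (hε : IsSubGaussianInnovation P ε Kε) (N : ℕ) (t : ℤ)
    (r : Fin p) : Measurable fun ω => truncatedProcess A ε N t ω r := by
  simp only [truncatedProcess, Finset.sum_apply, Matrix.mulVec, dotProduct]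
  exact Finset.measurable_sum _ fun a _ => Finset.measurable_sum _ fun q _ =>
    ((measurable_pi_apply q).comp (hε.measurable _)).const_mul _

/-- A single integrable function bounds the squares of all truncations: a multiple of
`∑_a ‖A_a‖ |ε_{t-a}|²`, whose expectation is finite because the filter is summable. -/
theorem exists_integrable_bound_truncatedProcess_sq [IsProbabilityMeasure P]
    (hε : IsSubGaussianInnovation P ε Kε)
    (hA : IsStableFilter A KA KA' β) (t : ℤ) :
    ∃ G : Ω → ℝ, Integrable G P ∧ ∀ᵐ ω ∂P, ∀ N r, truncatedProcess A ε N t ω r ^ 2 ≤ G ω := by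
  obtain ⟨σ, hσ, hKσ⟩ : ∃ σ : ℝ, 0 < σ ∧ Kε < σ :=
    ⟨max Kε 0 + 1, by positivity, by linarith [le_max_left Kε 0]⟩
  have hm : ∀ (τ : ℤ) (q : Fin p), Measurable fun ω => ε τ ω q := fun τ q =>
    (measurable_pi_apply q).comp (hε.measurable τ)
  let g : ℕ → Ω → ℝ := fun a ω => matrixOpNorm (A a) * ∑ q, ε (t - a) ω q ^ 2
  have hg0 : ∀ a ω, 0 ≤ g a ω := fun a ω =>
    mul_nonneg (matrixOpNorm_nonneg _) (Finset.sum_nonneg fun _ _ => sq_nonneg _)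
  have hgm : ∀ a, Measurable (g a) := fun a =>
    (Finset.measurable_sum _ fun q _ => (hm _ q).pow_const 2).const_mul _
  let H : Ω → ℝ≥0∞ := fun ω => ∑' a, ENNReal.ofReal (g a ω)
  have hHm : Measurable H := Measurable.tsum fun a => (hgm a).ennreal_ofReal
  have hga : ∀ a, ∫⁻ ω, ENNReal.ofReal (g a ω) ∂P
      ≤ ENNReal.ofReal (matrixOpNorm (A a) * (p * σ ^ 2)) := by
    intro a
    have hi : ∀ q, Integrable (fun ω => ε (t - a) ω q ^ 2) P := fun q =>
      integrable_sq_of_exp_sq hσ (hm _ q) (hε.lintegral_exp_sq_le hσ hKσ _ q)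
    rw [← ofReal_integral_eq_lintegral_ofReal
      ((integrable_finsetSum _ fun q _ => hi q).const_mul _) (ae_of_all _ (hg0 a))]
    refine ENNReal.ofReal_le_ofReal ?_
    rw [integral_const_mul, integral_finsetSum _ fun q _ => hi q]
    refine mul_le_mul_of_nonneg_left ?_ (matrixOpNorm_nonneg _)
    refine (Finset.sum_le_card_nsmul _ _ (σ ^ 2) fun q _ => ?_).trans (by simp)
    have := integral_sq_div_le_one hσ (hm (t - a) q) (hε.lintegral_exp_sq_le hσ hKσ _ q)
    rwa [integral_div, div_le_one (by positivity)] at this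
  have hHfin : ∫⁻ ω, H ω ∂P ≠ ∞ := by
    simp only [H]
    rw [lintegral_tsum fun a => (hgm a).ennreal_ofReal.aemeasurable]
    refine ne_top_of_le_ne_top ?_ (ENNReal.tsum_le_tsum hga)
    exact (hA.summable.mul_right (p * σ ^ 2)).tsum_ofReal_ne_top
  refine ⟨fun ω => KA * (H ω).toReal,
    (integrable_toReal_of_lintegral_ne_top hHm.aemeasurable hHfin).const_mul _, ?_⟩
  have hKA : 0 ≤ KA := (tsum_nonneg fun a => matrixOpNorm_nonneg (A a)).trans hA.tsum_le
  filter_upwards [ae_lt_top hHm hHfin] with ω hω N r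
  refine (truncatedProcess_sq_le hA N t ω r).trans (mul_le_mul_of_nonneg_left ?_ hKA)
  rw [← ENNReal.ofReal_le_iff_le_toReal hω.ne,
    ENNReal.ofReal_sum_of_nonneg fun a _ => hg0 a ω]
  exact ENNReal.sum_le_tsum _

theorem isDominatedLimit_truncatedProcess_mul [IsProbabilityMeasure P]
    (hZ : IsLinearProcess P Z A ε)
    (hε : IsSubGaussianInnovation P ε Kε) (hA : IsStableFilter A KA KA' β) (t t' : ℤ)
    (r s : Fin p) :
    IsDominatedLimit P (fun N ω => truncatedProcess A ε N t ω r * truncatedProcess A ε N t' ω s)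
      (fun ω => Z t ω r * Z t' ω s) := by
  obtain ⟨G, hG, hGb⟩ := exists_integrable_bound_truncatedProcess_sq hε hA t
  obtain ⟨G', hG', hGb'⟩ := exists_integrable_bound_truncatedProcess_sq hε hA t'
  have hlim : ∀ (t : ℤ) (r : Fin p), ∀ᵐ ω ∂P,
      Tendsto (fun N => truncatedProcess A ε N t ω r) atTop (𝓝 (Z t ω r)) := by
    intro t r
    filter_upwards [hZ t] with ω hω
    exact (tendsto_pi_nhds.1 hω.tendsto_sum_nat) r
  refine ⟨fun N => ((measurable_truncatedProcess hε N t r).mul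
    (measurable_truncatedProcess hε N t' s)).aestronglyMeasurable,
    ⟨fun ω => G ω + G' ω, hG.add hG', fun N => ?_⟩, ?_⟩
  · filter_upwards [hGb, hGb'] with ω h1 h2
    have h1' := h1 N r
    have h2' := h2 N s
    refine abs_le.2 ⟨?_, ?_⟩ <;>
      nlinarith [sq_nonneg (truncatedProcess A ε N t ω r + truncatedProcess A ε N t' ω s),
        sq_nonneg (truncatedProcess A ε N t ω r - truncatedProcess A ε N t' ω s),
        sq_nonneg (truncatedProcess A ε N t ω r), sq_nonneg (truncatedProcess A ε N t' ω s)]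
  · filter_upwards [hlim t r, hlim t' s] with ω h1 h2 using h1.mul h2

theorem isDominatedLimit_oracleLRV [IsProbabilityMeasure P]
    (hZ : IsLinearProcess P Z A ε)
    (hε : IsSubGaussianInnovation P ε Kε) (hA : IsStableFilter A KA KA' β) (K : ℝ → ℝ)
    (n m h ℓ : ℕ) (d : ℕ → ℝ) (r s : Fin p) :
    IsDominatedLimit P (fun N ω => oracleLRV K n m h ℓ d (truncatedProcess A ε N) ω r s)
      (fun ω => oracleLRV K n m h ℓ d Z ω r s) := by
  simp_rw [oracleLRV_apply, noiseDiff_apply, Finset.sum_mul_sum, mul_mul_mul_comm]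
  exact .sum _ fun k => .const_mul (.const_mul (.sum _ fun t => .sum _ fun j => .sum _ fun j' =>
    (isDominatedLimit_truncatedProcess_mul hZ hε hA _ _ r s).const_mul _) _) _

/-- The two-sided Chernoff bound. -/
theorem measureReal_lt_abs_le {Y : Ω → ℝ} (hY : AEMeasurable Y P) {u t B : ℝ} (hu : 0 ≤ u)
    (h1 : ∫⁻ ω, ENNReal.ofReal (Real.exp (u * Y ω)) ∂P ≤ ENNReal.ofReal (Real.exp B))
    (h2 : ∫⁻ ω, ENNReal.ofReal (Real.exp (-u * Y ω)) ∂P ≤ ENNReal.ofReal (Real.exp B)) :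
    P.real {ω | t < |Y ω|} ≤ 2 * Real.exp (B - u * t) := by
  have hm : ∀ c : ℝ, AEMeasurable (fun ω => ENNReal.ofReal (Real.exp (c * Y ω))) P := fun c =>
    (Real.measurable_exp.comp_aemeasurable (hY.const_mul c)).ennreal_ofReal
  have hsub : {ω | t < |Y ω|} ⊆ {ω | ENNReal.ofReal (Real.exp (u * t))
      ≤ ENNReal.ofReal (Real.exp (u * Y ω)) + ENNReal.ofReal (Real.exp (-u * Y ω))} := by
    intro ω hω
    rcases lt_abs.1 (show t < |Y ω| from hω) with h | h
    · refine le_add_right (ENNReal.ofReal_le_ofReal (Real.exp_le_exp.2 ?_))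
      exact mul_le_mul_of_nonneg_left h.le hu
    · refine le_add_left (ENNReal.ofReal_le_ofReal (Real.exp_le_exp.2 ?_))
      rw [neg_mul_comm]
      exact mul_le_mul_of_nonneg_left h.le hu
  have hmk := mul_meas_ge_le_lintegral₀ ((hm u).add (hm (-u))) (ENNReal.ofReal (Real.exp (u * t)))
  simp only [Pi.add_apply] at hmk
  rw [lintegral_add_left' (hm u)] at hmk
  have h3 : ENNReal.ofReal (Real.exp (u * t)) * P {ω | t < |Y ω|}
      ≤ ENNReal.ofReal (2 * Real.exp B) := by
    refine (mul_le_mul_right (measure_mono hsub) _).trans (hmk.trans ((add_le_add h1 h2).trans ?_))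
    rw [← ENNReal.ofReal_add (Real.exp_pos _).le (Real.exp_pos _).le, two_mul]
  have h4 := ENNReal.toReal_mono ENNReal.ofReal_ne_top h3
  rw [ENNReal.toReal_mul, ENNReal.toReal_ofReal (Real.exp_pos _).le,
    ENNReal.toReal_ofReal (by positivity)] at h4
  rw [Real.exp_sub, mul_div_assoc', le_div_iff₀ (Real.exp_pos _), mul_comm]
  exact h4

theorem min_sq_div_eq {t L : ℝ} (ht : 0 ≤ t) (hL : 0 ≤ L) :
    min (t ^ 2 / L) (t / L) = t * min t 1 / L := by
  rw [min_div_div_right hL, mul_min_of_nonneg _ _ ht, mul_one, sq]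

/-- The tail bound at scale `ℓ`, for each sample size. The Chernoff exponent is a multiple of
`(n / ℓ) min (t, 1)`, which keeps it in the range where the moment generating function is
controlled. -/
theorem measureReal_oracleLRV_le [IsProbabilityMeasure P]
    (hZ : IsLinearProcess P Z A ε)
    (hε : IsSubGaussianInnovation P ε Kε) (hσ : 0 < σ) (hKσ : Kε < σ)
    (hA : IsStableFilter A KA KA' β) {K : ℝ → ℝ} (hK : ∀ x : ℝ, |x| ≤ 1 → |K x| ≤ K₀)
    {n m h ℓ : ℕ} {d : ℕ → ℝ} (hd : ∑ j ∈ Finset.range (m + 1), |d j| ≤ Kd) {G : ℝ}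
    (hG1 : 1 ≤ G) (hG : σ ^ 2 * (Kd * KA) ^ 2 * K₀ ≤ G) (r s : Fin p) {t : ℝ} (ht : 0 < t) :
    P.real {ω | t < |oracleLRV K n m h ℓ d Z ω r s - ∫ ω', oracleLRV K n m h ℓ d Z ω' r s ∂P|}
      ≤ 2 * Real.exp (-((9600 * G ^ 2)⁻¹ * n * min (t ^ 2 / ℓ) (t / ℓ))) := by
  have hK0 : 0 ≤ K₀ := (abs_nonneg _).trans (hK 0 (by simp))
  -- for `n = 0` or `ℓ = 0` the right-hand side is `2`
  rcases Nat.eq_zero_or_pos n with hn | hn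
  · subst hn
    refine measureReal_le_one.trans ?_
    simp
  rcases Nat.eq_zero_or_pos ℓ with hℓ | hℓ
  · subst hℓ
    refine measureReal_le_one.trans ?_
    simp
  have hn' : (0 : ℝ) < n := by exact_mod_cast hn
  have hℓ' : (0 : ℝ) < ℓ := by exact_mod_cast hℓ
  have hG0 : 0 < G := by linarith
  set g := σ ^ 2 * (Kd * KA) ^ 2 * K₀ with hg
  have hg0 : 0 ≤ g := by positivity
  set y := min t 1 with hy
  have hy0 : 0 < y := lt_min ht one_pos
  have hy1 : y ≤ 1 := min_le_right _ _
  have hyt : y ≤ t := min_le_left _ _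
  set u := (4800 * G ^ 2)⁻¹ * (n / ℓ) * y with hu
  have hu0 : 0 ≤ u := by positivity
  have huℓ : u * (ℓ / n) = (4800 * G ^ 2)⁻¹ * y := by
    rw [hu]; field_simp
  have hmgf : ∀ v : ℝ, |v| = u → ∫⁻ ω, ENNReal.ofReal (Real.exp (v * (oracleLRV K n m h ℓ d Z ω r s
      - ∫ ω', oracleLRV K n m h ℓ d Z ω' r s ∂P))) ∂P
      ≤ ENNReal.ofReal (Real.exp (2400 * g ^ 2 * u ^ 2 * (ℓ / n))) := by
    intro v hv
    have hv2 : v ^ 2 = u ^ 2 := by rw [← hv, sq_abs]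
    rw [← hv2]
    refine (isDominatedLimit_oracleLRV hZ hε hA K n m h ℓ d r s).lintegral_exp_le fun N =>
      lintegral_exp_oracleLRV_truncatedProcess_le hε hσ hKσ hA hK hn hd r s ?_ N
    rw [hv, huℓ, ← hg]
    calc 80 * g * ((4800 * G ^ 2)⁻¹ * y) ≤ 80 * G * ((4800 * G ^ 2)⁻¹ * 1) := by gcongr
      _ = (60 * G)⁻¹ := by field_simp; norm_num
      _ ≤ 1 := inv_le_one_of_one_le₀ (by linarith)
  have hV := (isDominatedLimit_oracleLRV hZ hε hA K n m h ℓ d r s).integrable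
  refine (measureReal_lt_abs_le (hV.aestronglyMeasurable.aemeasurable.sub_const _) hu0
    (hmgf u (abs_of_nonneg hu0)) (hmgf (-u) (by rw [abs_neg, abs_of_nonneg hu0]))).trans ?_
  refine mul_le_mul_of_nonneg_left (Real.exp_le_exp.2 ?_) zero_le_two
  rw [min_sq_div_eq ht.le hℓ'.le, ← hy]
  have e1 : 2400 * g ^ 2 * u ^ 2 * (ℓ / n) ≤ (9600 * G ^ 2)⁻¹ * (n / ℓ) * (t * y) := by
    calc 2400 * g ^ 2 * u ^ 2 * (ℓ / n) = 2400 * g ^ 2 * u * (u * (ℓ / n)) := by ring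
      _ ≤ 2400 * G ^ 2 * u * (u * (ℓ / n)) := by gcongr
      _ = (9600 * G ^ 2)⁻¹ * (n / ℓ) * (y * y) := by
          rw [huℓ, hu]; field_simp; norm_num
      _ ≤ _ := by gcongr
  have e2 : u * t = 2 * ((9600 * G ^ 2)⁻¹ * (n / ℓ) * (t * y)) := by
    rw [hu]; field_simp; norm_num
  have e3 : (9600 * G ^ 2)⁻¹ * n * (t * y / ℓ) = (9600 * G ^ 2)⁻¹ * (n / ℓ) * (t * y) := by ring
  rw [e2, e3]
  linarith

end Limit

/-! ### The concentration inequalities -/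

theorem mainTheorem5 (Kε KA K₀ Kd : ℝ) :
    ∃ c₁ : ℝ, 0 < c₁ ∧
      ∀ (q₀ η KA' : ℝ), 0 < q₀ → 0 < η →
      ∀ (p m h ℓ : ℕ → ℕ) (d : ℕ → ℕ → ℝ) (K : ℝ → ℝ)
        (Ω : ℕ → Type*) [∀ n, MeasurableSpace (Ω n)]
        (P : ∀ n, Measure (Ω n)) [∀ n, IsProbabilityMeasure (P n)]
        (ε Z : ∀ n, ℤ → Ω n → Fin (p n) → ℝ)
        (A : ∀ n, ℕ → Matrix (Fin (p n)) (Fin (p n)) ℝ),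
      -- the noise is a linear process driven by the innovations
      (∀ n, IsLinearProcess (P n) (Z n) (A n) (ε n)) →
      (∀ n, IsSubGaussianInnovation (P n) (ε n) Kε) →
      (∀ n, IsStableFilter (A n) KA KA' (q₀ + 2 + η)) →
      -- kernel and normalized difference weights
      (∀ x : ℝ, |x| ≤ 1 → |K x| ≤ K₀) →
      (∀ n, ∑ j ∈ Finset.range (m n + 1), d n j = 0) →
      (∀ n, ∑ j ∈ Finset.range (m n + 1), d n j ^ 2 = 1) →
      (∀ n, ∑ j ∈ Finset.range (m n + 1), |d n j| ≤ Kd) →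
      -- bandwidth and spacing rates
      ((fun n => (ℓ n : ℝ)) =o[atTop] fun n => (h n : ℝ)) →
      Tendsto (fun n => (h n : ℝ) ^ (q₀ + 1 + η) / (ℓ n : ℝ) ^ (q₀ + 1)) atTop atTop →
      (∀ n, ℓ n ≤ h n) →
      -- the entries of the estimator have an expectation
      (∀ n, ∀ r s : Fin (p n),
        Integrable (fun ω => oracleLRV K n (m n) (h n) (ℓ n) (d n) (Z n) ω r s) (P n)) ∧
      -- the tail bound at scale `ℓ n`
      EntrywiseBernstein P (fun n => oracleLRV K n (m n) (h n) (ℓ n) (d n) (Z n))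
        (fun n => (ℓ n : ℝ)) c₁ ∧
      -- the entrywise concentration assumption, at scale `ℓ n + m n * h n`
      ∃ c : ℝ, 0 < c ∧
        EntrywiseBernstein P (fun n => oracleLRV K n (m n) (h n) (ℓ n) (d n) (Z n))
          (fun n => (ℓ n : ℝ) + (m n : ℝ) * (h n : ℝ)) c := by
  set σ : ℝ := |Kε| + 1 with hσ
  set G : ℝ := σ ^ 2 * (Kd * KA) ^ 2 * |K₀| + 1 with hG
  have hσ0 : 0 < σ := by positivity
  have hKσ : Kε < σ := by linarith [le_abs_self Kε]
  have hG1 : 1 ≤ G := by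
    have : 0 ≤ σ ^ 2 * (Kd * KA) ^ 2 * |K₀| := by positivity
    linarith
  have hGK : σ ^ 2 * (Kd * KA) ^ 2 * K₀ ≤ G := by
    have : σ ^ 2 * (Kd * KA) ^ 2 * K₀ ≤ σ ^ 2 * (Kd * KA) ^ 2 * |K₀| :=
      mul_le_mul_of_nonneg_left (le_abs_self K₀) (by positivity)
    linarith
  have hc : 0 < (9600 * G ^ 2)⁻¹ := by positivity
  refine ⟨(9600 * G ^ 2)⁻¹, hc, ?_⟩
  intro q₀ η KA' hq₀ hη p m h ℓ d K Ω _ P _ ε Z A hZ hε hA hK _ _ hd _ hrate _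
  have hmain : ∀ n, ∀ r s : Fin (p n), ∀ t : ℝ, 0 < t →
      (P n).real {ω | t < |oracleLRV K n (m n) (h n) (ℓ n) (d n) (Z n) ω r s
        - ∫ ω', oracleLRV K n (m n) (h n) (ℓ n) (d n) (Z n) ω' r s ∂(P n)|}
      ≤ 2 * Real.exp (-((9600 * G ^ 2)⁻¹ * n * min (t ^ 2 / ℓ n) (t / ℓ n))) :=
    fun n r s t ht => measureReal_oracleLRV_le (hZ n) (hε n) hσ0 hKσ (hA n) hK (hd n) hG1 hGK r s ht
  refine ⟨fun n r s => (isDominatedLimit_oracleLRV (hZ n) (hε n) (hA n) K n (m n) (h n) (ℓ n)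
    (d n) r s).integrable, Eventually.of_forall hmain, (9600 * G ^ 2)⁻¹, hc, ?_⟩
  -- enlarging the scale weakens the bound, provided that `ℓ n ≠ 0`: with `ℓ n = 0` the bound at
  -- scale `ℓ n` would be trivial, because of the convention `t / 0 = 0`
  filter_upwards [hrate.eventually_gt_atTop 0] with n hn r s t ht
  have hℓ : (0 : ℝ) < ℓ n := by
    refine (Nat.cast_nonneg (ℓ n)).lt_of_ne fun h0 => ?_
    rw [← h0, Real.zero_rpow (by linarith), div_zero] at hn
    exact lt_irrefl _ hn
  have hmh : (0 : ℝ) ≤ (m n : ℝ) * (h n : ℝ) := by positivity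
  refine (hmain n r s t ht).trans
    (mul_le_mul_of_nonneg_left (Real.exp_le_exp.2 (neg_le_neg ?_)) zero_le_two)
  have hle : (ℓ n : ℝ) ≤ ℓ n + (m n : ℝ) * (h n : ℝ) := by linarith
  gcongr
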